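/- Throughout, a \emph{signature} is a finite nonempty set $\sigma$ of relation symbols, each with an arity $\mathrm{ar}(R)\ge 1$. A \emph{structure} $\mathbb{A}$ in the signature $\sigma$ consists of a finite universe $A$ with $|A|\ge 2$ and, for each $R\in\sigma$, a relation $\emptyset\subsetneq R^{\mathbb{A}}\subsetneq A^{\mathrm{ar}(R)}$. A \emph{sentence} is a first-order sentence over $\sigma$ built from atomic formulas $R(x_1,\dots,x_{\mathrm{ar}(R)})$ using only $\exists,\forall,\wedge,\vee$ (no equality, no negation). A pair $(\mathbb{A},\mathbb{B})$ of structures in the same signature is a \emph{$\{\exists,\forall,\wedge,\vee\}$-PMC template} if every sentence true in $\mathbb{A}$ is true in $\mathbb{B}$. The promise problem $\mathrm{PMC}(\mathbb{A},\mathbb{B})$ has as inputs the sentences $\phi$ (encoded as words over a finite alphabet, with variable indices in binary); the Yes-instances are those with $\mathbb{A}\models\phi$ and the No-instances are those with $\mathbb{B}\not\models\phi$. Membership of a promise problem in a complexity class means that some machine obeys the resource bound of the class on every input sentence and answers correctly on all Yes-instances and all No-instances. A \emph{surjective multi-homomorphism} from $\mathbb{A}$ to $\mathbb{B}$ is a map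 $f$ assigning to each $a\in A$ a nonempty set $f(a)\subseteq B$ such that every $b\in B$ lies in some $f(a)$ and such that $f(a_1)\times\dots\times f(a_n)\subseteq R^{\mathbb{B}}$ whenever $R\in\sigma$ has arity $n$ and $(a_1,\dots,a_n)\in R^{\mathbb{A}}$. It is an \emph{A-shop} if $f(a^*)=B$ for some $a^*\in A$, and an \emph{E-shop} if there is $b^*\in B$ with $b^*\in f(a)$ for all $a\in A$. \textbf{Theorem.} Let $(\mathbb{A},\mathbb{B})$ be a $\{\exists,\forall,\wedge,\vee\}$-PMC template. \begin{enumerate} \item If there is an A-shop from $\mathbb{A}$ to $\mathbb{B}$, then $\mathrm{PMC}(\mathbb{A},\mathbb{B})$ is in $\mathrm{NP}$. \item If there is an E-shop from $\mathbb{A}$ to $\mathbb{B}$, then $\mathrm{PMC}(\mathbb{A},\mathbb{B})$ is in $\mathrm{coNP}$. \item If there is a surjective multi-homomorphism from $\mathbb{A}$ to $\mathbb{B}$ that is both an A-shop and an E-shop, then $\mathrm{PMC}(\mathbb{A},\mathbb{B})$ is in $\mathrm{L}$ (deterministic logarithmic space). Moreover, in this case there is a structure $\mathbb{C}$ in the same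 signature such that some surjective multi-homomorphism from $\mathbb{C}$ to $\mathbb{C}$ is both an A-shop and an E-shop, $(\mathbb{A},\mathbb{C})$ and $(\mathbb{C},\mathbb{B})$ are $\{\exists,\forall,\wedge,\vee\}$-PMC templates (that is, $(\mathbb{A},\mathbb{B})$ is a relaxation of $(\mathbb{C},\mathbb{C})$), and the non-promise problem $\mathrm{PMC}(\mathbb{C},\mathbb{C})$ is in $\mathrm{L}$. \end{enumerate} -/

import Mathlib

namespace PromiseMC

/-! ### Relational structures -/

/-- A finite nonempty relational signature; all arities are at least one. -/
structure Signature where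
  Sym : Type
  [finiteSym : Finite Sym]
  [nonemptySym : Nonempty Sym]
  arity : Sym → ℕ
  arity_pos : ∀ R, 1 ≤ arity R

attribute [instance] Signature.finiteSym Signature.nonemptySym

/-- A structure: a finite universe with at least two elements, and a nonempty proper relation for
each symbol of the signature. -/
structure RelStr (σ : Signature) where
  carrier : Type
  [finiteCarrier : Finite carrier]
  [nontrivialCarrier : Nontrivial carrier]
  rel : (R : σ.Sym) → Set (Fin (σ.arity R) → carrier)
  rel_nonempty : ∀ R, (rel R).Nonempty
  rel_proper : ∀ R, rel R ≠ Set.univ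

attribute [instance] RelStr.finiteCarrier RelStr.nontrivialCarrier

/-! ### Surjective multi-homomorphisms -/

/-- The inverse of a multi-valued function. -/
def mvInverse {α β : Type} (f : α → Set β) (b : β) : Set α := {a | b ∈ f a}

/-- `f` is a surjective multi-homomorphism from `A` to `B`. -/
structure IsSMuHom {σ : Signature} (A B : RelStr σ) (f : A.carrier → Set B.carrier) : Prop where
  value_nonempty : ∀ a, (f a).Nonempty
  surjective : ∀ b, ∃ a, b ∈ f a
  map_rel : ∀ (R : σ.Sym), ∀ a ∈ A.rel R, ∀ b : Fin (σ.arity R) → B.carrier,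
    (∀ i, b i ∈ f (a i)) → b ∈ B.rel R

/-- A surjective multi-homomorphism with `f(a*) = B` for some `a*`. -/
def IsAShop {σ : Signature} (A B : RelStr σ) (f : A.carrier → Set B.carrier) : Prop :=
  IsSMuHom A B f ∧ ∃ a, f a = Set.univ

/-- A surjective multi-homomorphism with `f⁻¹(b*) = A` for some `b*`. -/
def IsEShop {σ : Signature} (A B : RelStr σ) (f : A.carrier → Set B.carrier) : Prop :=
  IsSMuHom A B f ∧ ∃ b, mvInverse f b = Set.univ

/-- A surjective multi-homomorphism of both kinds simultaneously. -/
def IsEAShop {σ : Signature} (A B : RelStr σ) (f : A.carrier → Set B.carrier) : Prop :=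
  IsAShop A B f ∧ IsEShop A B f

/-! ### The fragment with `∃`, `∀`, `∧`, `∨` of first-order logic -/

/-- Formulas over the signature `σ`; the variables are named by natural numbers. -/
inductive Fml (σ : Signature) : Type
  | atom (R : σ.Sym) (v : Fin (σ.arity R) → ℕ) : Fml σ
  | and (φ ψ : Fml σ) : Fml σ
  | or (φ ψ : Fml σ) : Fml σ
  | ex (x : ℕ) (φ : Fml σ) : Fml σ
  | all (x : ℕ) (φ : Fml σ) : Fml σ

namespace Fml

variable {σ : Signature}

def freeVars : Fml σ → Set ℕ
  | atom _ v => Set.range v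
  | and φ ψ => φ.freeVars ∪ ψ.freeVars
  | or φ ψ => φ.freeVars ∪ ψ.freeVars
  | ex x φ => φ.freeVars \ {x}
  | all x φ => φ.freeVars \ {x}

/-- Satisfaction of a formula in `A` under the evaluation `s` of the variables. -/
def Sat (A : RelStr σ) : (ℕ → A.carrier) → Fml σ → Prop
  | s, atom R v => (fun i => s (v i)) ∈ A.rel R
  | s, and φ ψ => Sat A s φ ∧ Sat A s ψ
  | s, or φ ψ => Sat A s φ ∨ Sat A s ψ
  | s, ex x φ => ∃ a, Sat A (Function.update s x a) φ
  | s, all x φ => ∀ a, Sat A (Function.update s x a) φ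

end Fml

/-- A sentence is a formula without free variables. -/
def Sentence (σ : Signature) : Type := {φ : Fml σ // φ.freeVars = ∅}

/-- `A ⊨ φ`. The truth of a sentence does not depend on the evaluation of the variables. -/
def Models {σ : Signature} (A : RelStr σ) (φ : Sentence σ) : Prop :=
  ∀ s : ℕ → A.carrier, φ.1.Sat A s

/-- `(A, B)` is a template: every sentence true in `A` is true in `B`. -/
def IsTemplate {σ : Signature} (A B : RelStr σ) : Prop :=
  ∀ φ : Sentence σ, Models A φ → Models B φ

/-- The template `(C, D)` is a relaxation of the template `(A, B)`. -/
def IsRelaxation {σ : Signature} (C D A B : RelStr σ) : Prop :=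
  IsTemplate C A ∧ IsTemplate B D

/-! ### Sentences as words over a finite alphabet -/

inductive Token (σ : Signature) : Type
  | lparen : Token σ
  | rparen : Token σ
  | and : Token σ
  | or : Token σ
  | ex : Token σ
  | all : Token σ
  | comma : Token σ
  | bit (b : Bool) : Token σ
  | rel (R : σ.Sym) : Token σ

instance Token.finite (σ : Signature) : Finite (Token σ) := by
  let g : Fin 7 ⊕ Bool ⊕ σ.Sym → Token σ := fun
    | .inl i => ![.lparen, .rparen, .and, .or, .ex, .all, .comma] i
    | .inr (.inl b) => .bit b
    | .inr (.inr R) => .rel R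
  refine Finite.of_surjective g ?_
  intro t
  cases t with
  | lparen => exact ⟨.inl 0, rfl⟩
  | rparen => exact ⟨.inl 1, rfl⟩
  | and => exact ⟨.inl 2, rfl⟩
  | or => exact ⟨.inl 3, rfl⟩
  | ex => exact ⟨.inl 4, rfl⟩
  | all => exact ⟨.inl 5, rfl⟩
  | comma => exact ⟨.inl 6, rfl⟩
  | bit b => exact ⟨.inr (.inl b), rfl⟩
  | rel R => exact ⟨.inr (.inr R), rfl⟩

/-- A variable is written as its index in binary (least significant bit first), ended by a
comma. -/
def encodeVar (σ : Signature) (x : ℕ) : List (Token σ) :=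
  x.bits.map Token.bit ++ [Token.comma]

/-- Formulas are written in fully parenthesized infix notation: `R x,y,…,`, `(φ∧ψ)`, `(φ∨ψ)`,
`∃x,φ` and `∀x,φ`. -/
def Fml.encode {σ : Signature} : Fml σ → List (Token σ)
  | atom R v => Token.rel R :: (List.ofFn v).flatMap (encodeVar σ)
  | and φ ψ => Token.lparen :: (φ.encode ++ Token.and :: (ψ.encode ++ [Token.rparen]))
  | or φ ψ => Token.lparen :: (φ.encode ++ Token.or :: (ψ.encode ++ [Token.rparen]))
  | ex x φ => Token.ex :: (encodeVar σ x ++ φ.encode)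
  | all x φ => Token.all :: (encodeVar σ x ++ φ.encode)

theorem encodeVar_cancel {σ : Signature} {x y : ℕ} {r s : List (Token σ)}
    (h : encodeVar σ x ++ r = encodeVar σ y ++ s) : x = y ∧ r = s := by
  have key : ∀ (l m : List Bool), l.map Token.bit ++ [Token.comma] ++ r =
      m.map Token.bit ++ [Token.comma] ++ s → l = m ∧ r = s := by
    intro l
    induction l with
    | nil => intro m hm; cases m <;> simp_all
    | cons b l ih =>
      intro m hm
      cases m with
      | nil => simp_all
      | cons c m =>
        simp only [List.map_cons, List.cons_append, List.cons.injEq, Token.bit.injEq] at hm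
        obtain ⟨h1, h2⟩ := ih m hm.2
        exact ⟨by rw [hm.1, h1], h2⟩
  obtain ⟨h1, h2⟩ := key _ _ h
  refine ⟨?_, h2⟩
  apply Nat.eq_of_testBit_eq
  intro i
  rw [Nat.testBit_eq_inth, Nat.testBit_eq_inth, h1]

theorem Fml.encode_cancel {σ : Signature} (φ : Fml σ) :
    ∀ (ψ : Fml σ) (r s : List (Token σ)), φ.encode ++ r = ψ.encode ++ s → φ = ψ ∧ r = s := by
  induction φ with
  | atom R v =>
    intro ψ r s h
    cases ψ with
    | atom R' v' =>
      simp only [encode, List.cons_append, List.cons.injEq, Token.rel.injEq] at h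
      obtain ⟨rfl, h⟩ := h
      have key : ∀ l m : List ℕ, l.length = m.length →
          l.flatMap (encodeVar σ) ++ r = m.flatMap (encodeVar σ) ++ s → l = m ∧ r = s := by
        intro l
        induction l with
        | nil => intro m hm he; cases m <;> simp_all
        | cons a l ih =>
          intro m hm he
          cases m with
          | nil => simp at hm
          | cons b m =>
            simp only [List.flatMap_cons, List.append_assoc] at he
            obtain ⟨rfl, h2⟩ := encodeVar_cancel he
            obtain ⟨rfl, h3⟩ := ih m (by simpa using hm) h2
            exact ⟨rfl, h3⟩
      obtain ⟨h1, h2⟩ := key _ _ (by simp) h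
      rw [List.ofFn_injective h1]
      exact ⟨rfl, h2⟩
    | _ => simp [encode] at h
  | and φ₁ φ₂ ih₁ ih₂ =>
    intro ψ r s h
    cases ψ with
    | and ψ₁ ψ₂ =>
      simp only [encode, List.cons_append, List.append_assoc, List.cons.injEq, true_and] at h
      obtain ⟨rfl, h2⟩ := ih₁ _ _ _ h
      simp only [List.cons.injEq, true_and] at h2
      obtain ⟨rfl, h3⟩ := ih₂ _ _ _ h2
      simpa using h3
    | or ψ₁ ψ₂ =>
      simp only [encode, List.cons_append, List.append_assoc, List.cons.injEq, true_and] at h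
      have h2 := (ih₁ _ _ _ h).2
      simp at h2
    | _ => simp [encode] at h
  | or φ₁ φ₂ ih₁ ih₂ =>
    intro ψ r s h
    cases ψ with
    | or ψ₁ ψ₂ =>
      simp only [encode, List.cons_append, List.append_assoc, List.cons.injEq, true_and] at h
      obtain ⟨rfl, h2⟩ := ih₁ _ _ _ h
      simp only [List.cons.injEq, true_and] at h2
      obtain ⟨rfl, h3⟩ := ih₂ _ _ _ h2
      simpa using h3
    | and ψ₁ ψ₂ =>
      simp only [encode, List.cons_append, List.append_assoc, List.cons.injEq, true_and] at h
      have h2 := (ih₁ _ _ _ h).2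
      simp at h2
    | _ => simp [encode] at h
  | ex x φ ih =>
    intro ψ r s h
    cases ψ with
    | ex y ψ =>
      simp only [encode, List.cons_append, List.append_assoc, List.cons.injEq, true_and] at h
      obtain ⟨rfl, h2⟩ := encodeVar_cancel h
      obtain ⟨rfl, h3⟩ := ih _ _ _ h2
      exact ⟨rfl, h3⟩
    | _ => simp [encode] at h
  | all x φ ih =>
    intro ψ r s h
    cases ψ with
    | all y ψ =>
      simp only [encode, List.cons_append, List.append_assoc, List.cons.injEq, true_and] at h
      obtain ⟨rfl, h2⟩ := encodeVar_cancel h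
      obtain ⟨rfl, h3⟩ := ih _ _ _ h2
      exact ⟨rfl, h3⟩
    | _ => simp [encode] at h

/-! ### Turing machines -/

inductive Move : Type
  | left : Move
  | stay : Move
  | right : Move

/-- Symbols on the input tape: an input word is written between two end markers. -/
inductive InSym (Γ : Type) : Type
  | leftEnd : InSym Γ
  | sym (g : Γ) : InSym Γ
  | rightEnd : InSym Γ

/-- What a machine with states `Q`, work alphabet `S` and `k` work tapes does in one step. -/
structure Action (Q S : Type) (k : ℕ) where
  next : Q
  inMove : Move
  write : Fin k → S
  move : Fin k → Move

/-- A nondeterministic Turing machine with input alphabet `Γ`, a read-only two-way input tape and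
`k` work tapes, each infinite to the right. It halts when no action is available. -/
structure TM (Γ : Type) where
  Q : Type
  [finiteQ : Finite Q]
  S : Type
  [finiteS : Finite S]
  k : ℕ
  blank : S
  start : Q
  accepting : Set Q
  δ : Q → InSym Γ → (Fin k → S) → Set (Action Q S k)

attribute [instance] TM.finiteQ TM.finiteS

/-- The symbol in cell `p` of the input tape: cell `0` holds the left end marker, cells
`1, …, |x|` hold the input word `x`, and cell `|x| + 1` the right end marker. -/
def readInput {Γ : Type} (x : List Γ) : ℕ → InSym Γ
  | 0 => .leftEnd
  | p + 1 => match x[p]? with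
    | some g => .sym g
    | none => .rightEnd

/-- The head on a work tape does not move when it is told to leave cell `0` to the left. -/
def Move.work : Move → ℕ → ℕ
  | left, p => p - 1
  | stay, p => p
  | right, p => p + 1

/-- The head on the input tape stays between the end markers; `n` is the length of the input. -/
def Move.input (n : ℕ) : Move → ℕ → ℕ
  | left, p => p - 1
  | stay, p => p
  | right, p => min (p + 1) (n + 1)

namespace TM

variable {Γ : Type}

structure Cfg (M : TM Γ) where
  state : M.Q
  inHead : ℕ
  tape : Fin M.k → ℕ → M.S
  head : Fin M.k → ℕ

def initCfg (M : TM Γ) : M.Cfg where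
  state := M.start
  inHead := 0
  tape := fun _ _ => M.blank
  head := fun _ => 0

/-- The actions available in a configuration. -/
def actions (M : TM Γ) (x : List Γ) (c : M.Cfg) : Set (Action M.Q M.S M.k) :=
  M.δ c.state (readInput x c.inHead) (fun j => c.tape j (c.head j))

def applyAction (M : TM Γ) (x : List Γ) (c : M.Cfg) (a : Action M.Q M.S M.k) : M.Cfg where
  state := a.next
  inHead := a.inMove.input x.length c.inHead
  tape := fun j => Function.update (c.tape j) (c.head j) (a.write j)
  head := fun j => (a.move j).work (c.head j)

def Step (M : TM Γ) (x : List Γ) (c c' : M.Cfg) : Prop :=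
  ∃ a ∈ M.actions x c, c' = M.applyAction x c a

/-- Some computation on input `x` is in configuration `c` after exactly `t` steps. -/
def ReachesIn (M : TM Γ) (x : List Γ) : ℕ → M.Cfg → Prop
  | 0, c => c = M.initCfg
  | t + 1, c => ∃ c', M.ReachesIn x t c' ∧ M.Step x c' c

def Halted (M : TM Γ) (x : List Γ) (c : M.Cfg) : Prop := M.actions x c = ∅

/-- Some computation on input `x` halts. -/
def Halts (M : TM Γ) (x : List Γ) : Prop := ∃ t c, M.ReachesIn x t c ∧ M.Halted x c

/-- Some computation on input `x` halts in an accepting state. -/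
def Accepts (M : TM Γ) (x : List Γ) : Prop :=
  ∃ t c, M.ReachesIn x t c ∧ M.Halted x c ∧ c.state ∈ M.accepting

/-- Every computation on input `x` has at most `T` steps. -/
def RunsInTime (M : TM Γ) (x : List Γ) (T : ℕ) : Prop := ∀ t c, M.ReachesIn x t c → t ≤ T

/-- On input `x` at most the first `s` cells of each work tape are ever visited. -/
def RunsInSpace (M : TM Γ) (x : List Γ) (s : ℕ) : Prop :=
  ∀ t c, M.ReachesIn x t c → ∀ j, c.head j < s

def Deterministic (M : TM Γ) : Prop := ∀ q i w, (M.δ q i w).Subsingleton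

end TM

/-! ### Promise problems and complexity classes -/

/-- A promise problem: instances, written as words over a finite alphabet, with disjoint sets of
yes-instances and no-instances. -/
structure PromiseProblem where
  Inst : Type
  Alphabet : Type
  [finiteAlphabet : Finite Alphabet]
  encode : Inst → List Alphabet
  encode_injective : Function.Injective encode
  yes : Set Inst
  no : Set Inst
  yes_no_disjoint : Disjoint yes no

namespace PromiseProblem

/-- The problem with yes-instances and no-instances exchanged. -/
def swap (P : PromiseProblem) : PromiseProblem where
  Inst := P.Inst
  Alphabet := P.Alphabet
  finiteAlphabet := P.finiteAlphabet
  encode := P.encode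
  encode_injective := P.encode_injective
  yes := P.no
  no := P.yes
  yes_no_disjoint := P.yes_no_disjoint.symm

/-- Solvable in polynomial time by a nondeterministic Turing machine. The time bound holds for all
instances, whether or not they satisfy the promise. -/
def InNP (P : PromiseProblem) : Prop :=
  ∃ (M : TM P.Alphabet) (p : Polynomial ℕ),
    (∀ i, M.RunsInTime (P.encode i) (p.eval (P.encode i).length)) ∧
    (∀ i ∈ P.yes, M.Accepts (P.encode i)) ∧
    (∀ i ∈ P.no, ¬ M.Accepts (P.encode i))

def InCoNP (P : PromiseProblem) : Prop := P.swap.InNP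

/-- Solvable in logarithmic space by a deterministic Turing machine. Halting and the space bound
are required for all instances, whether or not they satisfy the promise. -/
def InL (P : PromiseProblem) : Prop :=
  ∃ (M : TM P.Alphabet) (c : ℕ), M.Deterministic ∧
    (∀ i, M.Halts (P.encode i)) ∧
    (∀ i, M.RunsInSpace (P.encode i) (c * (Nat.log 2 (P.encode i).length + 1))) ∧
    (∀ i ∈ P.yes, M.Accepts (P.encode i)) ∧
    (∀ i ∈ P.no, ¬ M.Accepts (P.encode i))

end PromiseProblem

/-- The promise model checking problem over the template `(A, B)`: distinguish the sentences true
in `A` from those not true in `B`. -/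
def PMC {σ : Signature} (A B : RelStr σ) (h : IsTemplate A B) : PromiseProblem where
  Inst := Sentence σ
  Alphabet := Token σ
  encode := fun φ => φ.1.encode
  encode_injective := fun φ ψ e =>
    Subtype.ext (Fml.encode_cancel φ.1 ψ.1 [] [] (by simpa using e)).1
  yes := {φ | Models A φ}
  no := {φ | ¬ Models B φ}
  yes_no_disjoint := Set.disjoint_left.2 fun φ hA hB => hB (h φ hA)

/-- The (non-promise) model checking problem over `C`. -/
def MC {σ : Signature} (C : RelStr σ) : PromiseProblem := PMC C C fun _ h => h

end PromiseMC

namespace PromiseMC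

open Relation

/-! Let `f` be a surjective multi-homomorphism from `A` to `B`. Truth passes from `A` to `B` along
evaluations `s`, `t` with `t x ∈ f (s x)`: nonempty values serve `∃`, surjectivity serves `∀`. If `f
a = B`, every element of `B` is related to `a`, so to prove a universal statement in `B` the single
instance `a` in `A` is enough (`Fml.sat_of_evalAt`). If `b` lies in every `f d`, any witness in `A`
may be replaced by `b` in `B` (`Fml.evalAt_of_sat`).

Hence, given an A-shop, evaluate in `A` with every `∀` set to `a`. No existential choice then
depends on a universal one, so a certificate is one element for each occurrence of `∃`: true
sentences of `A` have one, and any certificate implies truth in `B`. Given an E-shop, dually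
evaluate in `B` with every `∃` set to `b`; one element for each occurrence of `∀` certifies falsity.
If `f` is of both kinds, the part of `f` that sends `a` to `B` and everything else to `{b}` factors
through a structure `C` on `{0, 1}`. The map `0 ↦ {0, 1}`, `1 ↦ {1}` from `C` to `C` is of both
kinds and reflexive, so truth in `C` is evaluation with every `∀` set to `0` and every `∃` set to
`1`; no certificate remains.

What is left is to evaluate a formula whose quantifier occurrences carry fixed values. A
deterministic two-way automaton with three counters bounded by the input length plus one does this
(`Reading.run_eval`). It stores no evaluation: the value of an argument is recovered by walking left
to the binding quantifier and comparing names letter by letter. With counters in binary such an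
automaton runs in logarithmic space (`CounterAutomaton.inL_of_haltsIn`). It also halts in polynomial
time, having polynomially many configurations, so guessing the annotation beforehand gives `NP`
(`CounterAutomaton.inNP_of_haltsIn`). -/

/-! ### Runs of deterministic systems -/

/-- If a run of a deterministic system stays in `P` and ends in a configuration without successor,
then every reachable configuration lies on this run. -/
theorem reachable_of_maximal_run {α : Type} {r : α → α → Prop} {P : α → Prop}
    (hdet : ∀ a b c, r a b → r a c → b = c) {a b : α}
    (hab : ReflTransGen (fun u v => r u v ∧ P v) a b) (hb : ∀ c, ¬ r b c) {c : α}
    (hac : ReflTransGen r a c) :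
    ReflTransGen (fun u v => r u v ∧ P v) a c ∧ ReflTransGen (fun u v => r u v ∧ P v) c b := by
  induction hab using ReflTransGen.head_induction_on with
  | refl =>
    rcases ReflTransGen.cases_head hac with rfl | ⟨d, hd, -⟩
    · exact ⟨.refl, .refl⟩
    · exact absurd hd (hb d)
  | @head u v huv hvb ih =>
    rcases ReflTransGen.cases_head hac with rfl | ⟨d, hd, hdc⟩
    · exact ⟨.refl, .head huv hvb⟩
    · obtain rfl := hdet _ _ _ huv.1 hd
      exact ⟨.head huv (ih hdc).1, (ih hdc).2⟩

theorem property_of_run {α : Type} {r : α → α → Prop} {P : α → Prop} {a b : α}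
    (hab : ReflTransGen (fun u v => r u v ∧ P v) a b) (ha : P a) : P b := by
  rcases ReflTransGen.cases_tail hab with rfl | ⟨c, -, h⟩
  · exact ha
  · exact h.2

namespace TM

variable {Γ : Type} {M : TM Γ} {x : List Γ}

theorem exists_reachesIn_iff {c : M.Cfg} :
    (∃ t, M.ReachesIn x t c) ↔ ReflTransGen (M.Step x) M.initCfg c := by
  constructor
  · rintro ⟨t, h⟩
    induction t generalizing c with
    | zero => rw [show c = M.initCfg from h]
    | succ t ih =>
      obtain ⟨c', h', hs⟩ := h
      exact (ih h').tail hs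
  · intro h
    induction h with
    | refl => exact ⟨0, rfl⟩
    | tail _ hs ih =>
      obtain ⟨t, ht⟩ := ih
      exact ⟨t + 1, _, ht, hs⟩

theorem Deterministic.step_unique (hM : M.Deterministic) (a b c : M.Cfg) (hb : M.Step x a b)
    (hc : M.Step x a c) : b = c := by
  obtain ⟨u, hu, rfl⟩ := hb
  obtain ⟨v, hv, rfl⟩ := hc
  rw [hM _ _ _ hu hv]

end TM

/-! ### Counter automata -/

/-- A deterministic automaton with a two-way read-only input tape and `m` counters, which can be
incremented, decremented and tested for zero. -/
structure CounterAutomaton (Γ : Type) where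
  Q : Type
  [finiteQ : Finite Q]
  m : ℕ
  start : Q
  δ : Q → InSym Γ → (Fin m → Bool) → Option (Q × Move × (Fin m → Move))

attribute [instance] CounterAutomaton.finiteQ

namespace CounterAutomaton

variable {Γ : Type}

@[ext]
structure Cfg (M : CounterAutomaton Γ) where
  state : M.Q
  pos : ℕ
  ctr : Fin M.m → ℕ

def initCfg (M : CounterAutomaton Γ) : M.Cfg := ⟨M.start, 0, fun _ => 0⟩

/-- The instruction to be executed in a configuration. -/
def instr (M : CounterAutomaton Γ) (x : List Γ) (c : M.Cfg) :
    Option (M.Q × Move × (Fin M.m → Move)) :=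
  M.δ c.state (readInput x c.pos) (fun j => decide (c.ctr j = 0))

def exec (M : CounterAutomaton Γ) (x : List Γ) (c : M.Cfg) (r : M.Q × Move × (Fin M.m → Move)) :
    M.Cfg :=
  ⟨r.1, r.2.1.input x.length c.pos, fun j => (r.2.2 j).work (c.ctr j)⟩

def step (M : CounterAutomaton Γ) (x : List Γ) (c : M.Cfg) : Option M.Cfg :=
  (M.instr x c).map (M.exec x c)

/-- A step after which no counter exceeds the length of the input plus one. -/
def BStep (M : CounterAutomaton Γ) (x : List Γ) (c c' : M.Cfg) : Prop :=
  M.step x c = some c' ∧ ∀ j, c'.ctr j ≤ x.length + 1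

/-- The automaton halts in state `q`, and no counter ever exceeds the length of the input plus
one. -/
def HaltsIn (M : CounterAutomaton Γ) (x : List Γ) (q : M.Q) : Prop :=
  ∃ c, ReflTransGen (M.BStep x) M.initCfg c ∧ M.step x c = none ∧ c.state = q

end CounterAutomaton

/-! ### Binary counters on a work tape -/

/-- Tape symbols of a binary counter: cell `0` holds the mark, the following cells the bits,
least significant bit first. -/
inductive CtrSym : Type
  | blank : CtrSym
  | mark : CtrSym
  | bit (b : Bool) : CtrSym

instance CtrSym.finite : Finite CtrSym :=
  Finite.of_surjective (fun s : Option (Option Bool) => match s with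
    | none => CtrSym.blank
    | some none => CtrSym.mark
    | some (some b) => CtrSym.bit b) fun t => by
    cases t with
    | blank => exact ⟨none, rfl⟩
    | mark => exact ⟨some none, rfl⟩
    | bit b => exact ⟨some (some b), rfl⟩

/-- The phases of the head on the tape of a binary counter. An idle counter knows whether its value
is zero. -/
inductive CtrPhase : Type
  | blankTape : CtrPhase
  | idle (z : Bool) : CtrPhase
  | inc : CtrPhase
  | dec : CtrPhase
  | toEnd : CtrPhase
  | back (z : Bool) : CtrPhase

instance CtrPhase.finite : Finite CtrPhase :=
  Finite.of_surjective (fun s : Fin 4 ⊕ Bool ⊕ Bool => match s with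
    | .inl i => ![blankTape, inc, dec, toEnd] i
    | .inr (.inl b) => idle b
    | .inr (.inr b) => back b) fun t => by
    cases t with
    | blankTape => exact ⟨.inl 0, rfl⟩
    | inc => exact ⟨.inl 1, rfl⟩
    | dec => exact ⟨.inl 2, rfl⟩
    | toEnd => exact ⟨.inl 3, rfl⟩
    | idle b => exact ⟨.inr (.inl b), rfl⟩
    | back b => exact ⟨.inr (.inr b), rfl⟩

namespace CtrPhase

/-- The phases `inc` and `dec` propagate the carry or borrow to the right. Then `toEnd` walks to the
first blank, and `back` returns over all bits to the mark; its flag starts as `true` and falls at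
the first bit `1`, so the zero test is recomputed after each operation. -/
def act : CtrPhase → CtrSym → CtrPhase × CtrSym × Move
  | blankTape, _ => (idle true, .mark, .stay)
  | idle z, s => (idle z, s, .stay)
  | inc, .bit true => (inc, .bit false, .right)
  | inc, .mark => (inc, .mark, .right)
  | inc, _ => (toEnd, .bit true, .right)
  | dec, .bit false => (dec, .bit true, .right)
  | dec, .bit true => (toEnd, .bit false, .right)
  | dec, .mark => (dec, .mark, .right)
  | dec, .blank => (toEnd, .blank, .stay)
  | toEnd, .blank => (back true, .blank, .left)
  | toEnd, s => (toEnd, s, .right)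
  | back z, .mark => (idle z, .mark, .stay)
  | back _, .bit true => (back false, .bit true, .left)
  | back z, s => (back z, s, .left)

def IsIdle : CtrPhase → Prop
  | idle _ => True
  | _ => False

def isZero : CtrPhase → Bool
  | idle z => z
  | _ => false

/-- The phase in which an idle counter starts to execute a counter operation. -/
def begin (p : CtrPhase) : Move → CtrPhase
  | .right => inc
  | .left => if p.isZero then p else dec
  | .stay => p

end CtrPhase

/-- A configuration of a single counter tape. -/
@[ext]
structure CtrCfg where
  phase : CtrPhase
  tape : ℕ → CtrSym
  head : ℕ

namespace CtrCfg

def step (c : CtrCfg) : CtrCfg :=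
  let a := c.phase.act (c.tape c.head)
  ⟨a.1, Function.update c.tape c.head a.2.1, a.2.2.work c.head⟩

theorem step_of_idle {c : CtrCfg} (h : c.phase.IsIdle) : c.step = c := by
  obtain ⟨ph, tp, hd⟩ := c
  cases ph <;> simp_all [CtrPhase.IsIdle, step, CtrPhase.act, Move.work]

/-- The tape with content `l`, followed by blanks. -/
def tapeOf (l : List CtrSym) (p : ℕ) : CtrSym := l.getD p .blank

/-- The configuration with `a` to the left of the head and `c` from the head on. -/
def zip (ph : CtrPhase) (a c : List CtrSym) : CtrCfg := ⟨ph, tapeOf (a ++ c), a.length⟩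

theorem tapeOf_length_cons (a : List CtrSym) (b : CtrSym) (c : List CtrSym) :
    tapeOf (a ++ b :: c) a.length = b := by
  simp [tapeOf]

theorem tapeOf_length (a : List CtrSym) : tapeOf a a.length = .blank := by
  simp [tapeOf]

theorem update_tapeOf_cons (a : List CtrSym) (b b' : CtrSym) (c : List CtrSym) :
    Function.update (tapeOf (a ++ b :: c)) a.length b' = tapeOf (a ++ b' :: c) := by
  funext p
  rcases lt_trichotomy p a.length with h | rfl | h
  · rw [Function.update_of_ne h.ne]
    simp [tapeOf, List.getElem?_append_left h]
  · simp [tapeOf]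
  · rw [Function.update_of_ne h.ne']
    obtain ⟨k, rfl⟩ := Nat.exists_eq_add_of_lt h
    simp [tapeOf, List.getElem?_append_right, Nat.add_assoc]

theorem tapeOf_append_blank (a : List CtrSym) : tapeOf (a ++ [.blank]) = tapeOf a := by
  funext p
  rcases lt_trichotomy p a.length with h | rfl | h
  · simp [tapeOf, List.getElem?_append_left h]
  · simp [tapeOf]
  · simp [tapeOf, List.getElem?_append_right h.le, List.getElem?_eq_none h.le,
      List.getElem?_eq_none (show [CtrSym.blank].length ≤ p - a.length by simp; omega)]

theorem update_tapeOf_end (a : List CtrSym) (b' : CtrSym) :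
    Function.update (tapeOf a) a.length b' = tapeOf (a ++ [b']) := by
  rw [← tapeOf_append_blank, update_tapeOf_cons]

/-- With the tape split at the head, a step only shifts the boundary between two lists. This and the
next three lemmas are the only places where tapes are treated as functions in the runs over bits. -/
theorem step_zip_right {ph ph' : CtrPhase} {b b' : CtrSym} (h : ph.act b = (ph', b', .right))
    (a c : List CtrSym) : (zip ph a (b :: c)).step = zip ph' (a ++ [b']) c := by
  simp [step, zip, tapeOf_length_cons, h, update_tapeOf_cons, Move.work]

theorem step_zip_right_end {ph ph' : CtrPhase} {b' : CtrSym}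
    (h : ph.act .blank = (ph', b', .right)) (a : List CtrSym) :
    (zip ph a []).step = zip ph' (a ++ [b']) [] := by
  simp [step, zip, tapeOf_length, h, update_tapeOf_end, Move.work]

theorem step_zip_left {ph ph' : CtrPhase} {b : CtrSym} (h : ph.act b = (ph', b, .left))
    (a c : List CtrSym) (e : CtrSym) :
    (zip ph (a ++ [e]) (b :: c)).step = zip ph' a (e :: b :: c) := by
  have h1 := tapeOf_length_cons (a ++ [e]) b c
  have h2 := update_tapeOf_cons (a ++ [e]) b b c
  simp only [List.length_append, List.length_singleton] at h1 h2
  simp only [step, zip, List.length_append, List.length_singleton, h1, h, h2, Move.work]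
  simp

theorem step_zip_left_end {ph ph' : CtrPhase} (h : ph.act .blank = (ph', .blank, .left))
    (a : List CtrSym) (e : CtrSym) : (zip ph (a ++ [e]) []).step = zip ph' a [e] := by
  have h1 := tapeOf_length (a ++ [e])
  have h2 := update_tapeOf_end (a ++ [e]) .blank
  rw [tapeOf_append_blank] at h2
  simp only [List.length_append, List.length_singleton] at h1 h2
  simp only [step, zip, List.length_append, List.length_singleton, List.append_nil, h1, h, h2,
    Move.work]
  simp

/-- The value of a list of bits, least significant bit first. -/
def value : List Bool → ℕ
  | [] => 0
  | b :: l => b.toNat + 2 * value l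

/-- Runs on which the head stays in the cells `0, …, B`. -/
def Run (B : ℕ) : CtrCfg → CtrCfg → Prop :=
  ReflTransGen fun c c' => c' = c.step ∧ c'.head ≤ B

/-- Idle with value given by the bits `l`. -/
def idleOf (l : List Bool) : CtrCfg :=
  zip (.idle (decide (value l = 0))) [] (.mark :: l.map .bit)

theorem Run.single {B : ℕ} {c c' : CtrCfg} (h : c.step = c') (hB : c'.head ≤ B) : Run B c c' :=
  ReflTransGen.single ⟨h.symm, hB⟩

/-- The flag of `back` always tells whether the bits strictly to the right of the head are all zero.
The induction removes bits of `l` from its right end, the side from which the head arrives. -/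
theorem run_back_list {B : ℕ} (l : List Bool) : ∀ (b : Bool) (r : List Bool), l.length + 1 ≤ B →
    Run B (zip (.back (decide (value r = 0))) (.mark :: l.map .bit) ((b :: r).map .bit))
      (idleOf (l ++ b :: r)) := by
  induction l using List.reverseRecOn with
  | nil =>
    intro b r hB
    refine ReflTransGen.trans (Run.single (c' := zip (.back (decide (value (b :: r) = 0))) []
      (.mark :: (b :: r).map .bit)) ?_ (by simp [zip])) (Run.single ?_ (by simp [zip, idleOf]))
    · refine step_zip_left (a := []) (e := .mark) ?_ _
      cases b <;> simp [CtrPhase.act, value]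
    · have h := update_tapeOf_cons [] .mark .mark ((b :: r).map .bit)
      simp only [List.nil_append, List.length_nil] at h
      simp only [step, zip, idleOf, List.nil_append, List.length_nil]
      rw [show tapeOf (.mark :: (b :: r).map .bit) 0 = .mark from rfl]
      simp only [CtrPhase.act, h, Move.work]
  | append_singleton l e ih =>
    intro b r hB
    simp only [List.length_append, List.length_singleton] at hB
    refine ReflTransGen.trans (Run.single (c' := zip (.back (decide (value (b :: r) = 0)))
      (.mark :: l.map .bit) ((e :: b :: r).map .bit)) ?_ (by simp [zip]; omega)) ?_
    · rw [List.map_append, ← List.cons_append]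
      refine step_zip_left ?_ _ _ _
      cases b <;> simp [CtrPhase.act, value]
    · rw [List.append_assoc]
      exact ih e (b :: r) (by omega)

/-- Nonemptiness guarantees that the step back from the first blank lands on a bit and not on the
mark, as `run_back_list` requires. -/
theorem run_toEnd {B : ℕ} (r : List Bool) : ∀ (l : List Bool), l.length + r.length + 1 ≤ B →
    l ++ r ≠ [] →
    Run B (zip .toEnd (.mark :: l.map .bit) (r.map .bit)) (idleOf (l ++ r)) := by
  induction r with
  | nil =>
    intro l hB hl
    simp only [List.append_nil] at hl ⊢
    obtain ⟨l, e, rfl⟩ := (List.eq_nil_or_concat' l).resolve_left hl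
    simp only [List.length_append, List.length_singleton, List.length_nil] at hB
    refine ReflTransGen.trans (Run.single (c' := zip (.back (decide (value [] = 0)))
      (.mark :: l.map .bit) ([e].map .bit)) ?_ (by simp [zip]; omega))
      (run_back_list l e [] (by omega))
    rw [List.map_append, ← List.cons_append]
    exact step_zip_left_end (by simp [CtrPhase.act, value]) _ _
  | cons b r ih =>
    intro l hB hl
    simp only [List.length_cons] at hB
    have := ih (l ++ [b]) (by simp; omega) (by simp)
    rw [List.append_assoc] at this
    refine ReflTransGen.trans (Run.single ?_ ?_) this
    · rw [List.map_append, ← List.cons_append]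
      exact step_zip_right rfl _ _
    · simp [zip]; omega

/-- Incrementing a binary counter. -/
theorem run_inc {B : ℕ} (r : List Bool) : ∀ (l : List Bool),
    ∃ r' : List Bool, value r' = value r + 1 ∧ r' ≠ [] ∧
      (r'.length = r.length ∨ (r'.length = r.length + 1 ∧ 2 ^ r.length = value r + 1)) ∧
      (l.length + r'.length + 1 ≤ B →
        Run B (zip .inc (.mark :: l.map .bit) (r.map .bit)) (idleOf (l ++ r'))) := by
  induction r with
  | nil =>
    intro l
    refine ⟨[true], rfl, by simp, .inr ⟨rfl, rfl⟩, fun hB => ?_⟩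
    have := run_toEnd (B := B) [] (l ++ [true]) (by simpa using hB) (by simp)
    rw [List.append_nil] at this
    refine ReflTransGen.trans (Run.single ?_ ?_) this
    · rw [List.map_append, ← List.cons_append]
      exact step_zip_right_end rfl _
    · simp [zip] at hB ⊢; omega
  | cons b r ih =>
    intro l
    cases b with
    | false =>
      refine ⟨true :: r, by simp [value]; ring, by simp, .inl rfl, fun hB => ?_⟩
      have := run_toEnd (B := B) r (l ++ [true]) (by simp at hB ⊢; omega) (by simp)
      rw [List.append_assoc] at this
      refine ReflTransGen.trans (Run.single ?_ ?_) this
      · rw [List.map_append, ← List.cons_append]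
        exact step_zip_right rfl _ _
      · simp [zip] at hB ⊢; omega
    | true =>
      obtain ⟨r', h1, h2, h3, h4⟩ := ih (l ++ [false])
      refine ⟨false :: r', ?_, by simp, ?_, fun hB => ?_⟩
      · simp [value, h1]; ring
      · refine h3.imp (by simp) fun h => ⟨by simp [h.1], ?_⟩
        simp [value, pow_succ, h.2]; ring
      · have := h4 (by simp at hB ⊢; omega)
        rw [List.append_assoc] at this
        refine ReflTransGen.trans (Run.single ?_ ?_) this
        · rw [List.map_append, ← List.cons_append]
          exact step_zip_right rfl _ _
        · simp [zip] at hB ⊢; omega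

/-- Decrementing a binary counter that is not zero. -/
theorem run_dec {B : ℕ} (r : List Bool) : ∀ (l : List Bool), value r ≠ 0 →
    ∃ r' : List Bool, value r' = value r - 1 ∧ r'.length = r.length ∧
      (l.length + r.length + 1 ≤ B →
        Run B (zip .dec (.mark :: l.map .bit) (r.map .bit)) (idleOf (l ++ r'))) := by
  induction r with
  | nil => intro l h; exact absurd rfl h
  | cons b r ih =>
    intro l hr
    cases b with
    | true =>
      refine ⟨false :: r, by simp [value], by simp, fun hB => ?_⟩
      have := run_toEnd (B := B) r (l ++ [false]) (by simp at hB ⊢; omega) (by simp)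
      rw [List.append_assoc] at this
      refine ReflTransGen.trans (Run.single ?_ ?_) this
      · rw [List.map_append, ← List.cons_append]
        exact step_zip_right rfl _ _
      · simp [zip] at hB ⊢; omega
    | false =>
      have hr' : value r ≠ 0 := by simpa [value] using hr
      obtain ⟨r', h1, h2, h4⟩ := ih (l ++ [true]) hr'
      refine ⟨true :: r', ?_, by simp [h2], fun hB => ?_⟩
      · simp [value, h1]; omega
      · have := h4 (by simp at hB ⊢; omega)
        rw [List.append_assoc] at this
        refine ReflTransGen.trans (Run.single ?_ ?_) this
        · rw [List.map_append, ← List.cons_append]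
          exact step_zip_right rfl _ _
        · simp [zip] at hB ⊢; omega

/-- Executing a counter operation `mv`, from an idle counter to an idle counter. -/
theorem run_begin {N : ℕ} {l : List Bool} (hl : l.length ≤ Nat.log 2 N + 1) (mv : Move)
    (hN : mv.work (value l) ≤ N) :
    ∃ l' : List Bool, value l' = mv.work (value l) ∧ l'.length ≤ Nat.log 2 N + 1 ∧
      Run (Nat.log 2 N + 2)
        ⟨(idleOf l).phase.begin mv, (idleOf l).tape, 0⟩ (idleOf l') := by
  cases mv with
  | stay => exact ⟨l, rfl, hl, .refl⟩
  | right =>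
    obtain ⟨l', h1, -, h3, h4⟩ := run_inc (B := Nat.log 2 N + 2) l []
    -- The word gets longer only if all its bits were `1`. Then the new value is `2 ^ l.length`, and
    -- being at most `N` it bounds the old length by `Nat.log 2 N`.
    have hl' : l'.length ≤ Nat.log 2 N + 1 := by
      rcases h3 with h3 | ⟨h3, h5⟩
      · omega
      · simp only [Move.work] at hN
        have := Nat.le_log_of_pow_le (b := 2) (by norm_num) (h5.trans_le hN)
        omega
    refine ⟨l', h1, hl', ReflTransGen.trans (Run.single ?_ ?_) (h4 ?_)⟩
    · exact step_zip_right (ph := .inc) (b := .mark) rfl [] _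
    · simp [zip]
    · simp; omega
  | left =>
    by_cases h0 : value l = 0
    · refine ⟨l, by simp [Move.work, h0], hl, ?_⟩
      simp only [idleOf, zip, CtrPhase.begin, CtrPhase.isZero, h0]
      exact .refl
    · obtain ⟨l', h1, h2, h4⟩ := run_dec (B := Nat.log 2 N + 2) l [] h0
      refine ⟨l', h1, by omega, ?_⟩
      simp only [idleOf, zip, CtrPhase.begin, CtrPhase.isZero, h0, decide_false]
      refine ReflTransGen.trans (Run.single ?_ ?_) (h4 ?_)
      · exact step_zip_right (ph := .dec) (b := .mark) rfl [] _
      · simp [zip]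
      · simp; omega

/-- Idle configurations are fixed by `step`, so the head bound extends to all iterates. This lets
counter tapes with different running times wait for each other. -/
theorem Run.iterate {B : ℕ} {c e : CtrCfg} (h : Run B c e) (he : e.phase.IsIdle)
    (hc : c.head ≤ B) : ∃ T, step^[T] c = e ∧ ∀ t, (step^[t] c).head ≤ B := by
  induction h using ReflTransGen.head_induction_on with
  | refl => exact ⟨0, rfl, fun t => by rwa [Function.iterate_fixed (step_of_idle he)]⟩
  | head h _ ih =>
    obtain ⟨T, hT, hb⟩ := ih h.2
    refine ⟨T + 1, by rw [Function.iterate_succ_apply, ← h.1, hT], fun t => ?_⟩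
    cases t with
    | zero => exact hc
    | succ t => rw [Function.iterate_succ_apply, ← h.1]; exact hb t

end CtrCfg

/-! ### Counter automata in logarithmic space -/

namespace CounterAutomaton

variable {Γ : Type}

open Classical in
/-- The Turing machine that keeps every counter in binary on its own work tape. All counter tapes
work in parallel, and the next instruction is executed when all of them are idle. -/
noncomputable def toLogTM (M : CounterAutomaton Γ) (F : Set M.Q) : TM Γ where
  Q := M.Q × (Fin M.m → CtrPhase)
  S := CtrSym
  k := M.m
  blank := .blank
  start := (M.start, fun _ => .blankTape)
  accepting := {q | q.1 ∈ F}
  δ := fun q i w =>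
    if ∀ j, (q.2 j).IsIdle then
      {a | ∃ r ∈ M.δ q.1 i (fun j => (q.2 j).isZero),
        a = ⟨(r.1, fun j => (q.2 j).begin (r.2.2 j)), r.2.1, w, fun _ => .stay⟩}
    else
      {⟨(q.1, fun j => ((q.2 j).act (w j)).1), .stay, fun j => ((q.2 j).act (w j)).2.1,
        fun j => ((q.2 j).act (w j)).2.2⟩}

variable {M : CounterAutomaton Γ} {F : Set M.Q} {x : List Γ}

theorem toLogTM_deterministic : (M.toLogTM F).Deterministic := by
  intro q i w a ha b hb
  simp only [toLogTM] at ha hb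
  split_ifs at ha hb with h
  · obtain ⟨r, hr, rfl⟩ := ha
    obtain ⟨r', hr', rfl⟩ := hb
    rw [Option.mem_unique hr hr']
  · rw [ha, hb]

/-- The configuration assembled from the control state, the input head and the counter tapes. -/
def logCfg (F : Set M.Q) (q : M.Q) (p : ℕ) (L : Fin M.m → CtrCfg) : (M.toLogTM F).Cfg where
  state := (q, fun j => (L j).phase)
  inHead := p
  tape := fun j => (L j).tape
  head := fun j => (L j).head

/-- Steps of the Turing machine after which all work heads are in the cells `0, …, B`. -/
def LogStep (F : Set M.Q) (x : List Γ) (B : ℕ) (d d' : (M.toLogTM F).Cfg) : Prop :=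
  (M.toLogTM F).Step x d d' ∧ ∀ j, d'.head j ≤ B

theorem logStep_busy {B : ℕ} {q : M.Q} {p : ℕ} {L : Fin M.m → CtrCfg}
    (h : ¬ ∀ j, (L j).phase.IsIdle) (hB : ∀ j, (L j).step.head ≤ B) :
    LogStep F x B (logCfg F q p L) (logCfg F q p fun j => (L j).step) := by
  refine ⟨⟨⟨(q, fun j => (L j).step.phase), .stay,
    fun j => ((L j).phase.act ((L j).tape (L j).head)).2.1,
    fun j => ((L j).phase.act ((L j).tape (L j).head)).2.2⟩, ?_, rfl⟩, hB⟩
  simp only [TM.actions, toLogTM, logCfg]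
  rw [if_neg h]
  rfl

theorem logStep_iterate {B : ℕ} {q : M.Q} {p : ℕ} (T : ℕ) : ∀ {L : Fin M.m → CtrCfg},
    (∀ j, (CtrCfg.step^[T] (L j)).phase.IsIdle) →
    (∀ j t, (CtrCfg.step^[t] (L j)).head ≤ B) →
    ReflTransGen (LogStep F x B) (logCfg F q p L)
      (logCfg F q p fun j => CtrCfg.step^[T] (L j)) := by
  induction T with
  | zero => intro L _ _; exact .refl
  | succ T ih =>
    intro L h1 h2
    -- Once all tapes are idle the Turing machine would already execute the next instruction, so the
    -- run has to stop here; the remaining iterates change nothing.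
    by_cases h : ∀ j, (L j).phase.IsIdle
    · rw [show (fun j => CtrCfg.step^[T + 1] (L j)) = L from
        funext fun j => Function.iterate_fixed (CtrCfg.step_of_idle (h j)) _]
    · exact .head (logStep_busy h fun j => h2 j 1) (ih h1 fun j t => h2 j (t + 1))

/-- All counter tapes run until all are idle. -/
theorem logStep_run {B : ℕ} {q : M.Q} {p : ℕ} {L E : Fin M.m → CtrCfg}
    (h : ∀ j, CtrCfg.Run B (L j) (E j)) (hE : ∀ j, (E j).phase.IsIdle)
    (hL : ∀ j, (L j).head ≤ B) :
    ReflTransGen (LogStep F x B) (logCfg F q p L) (logCfg F q p E) := by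
  choose T hT hb using fun j => (h j).iterate (hE j) (hL j)
  -- The sum of the individual running times serves as a common duration.
  have key : ∀ j, CtrCfg.step^[∑ i, T i] (L j) = E j := fun j => by
    obtain ⟨k, hk⟩ := Nat.exists_eq_add_of_le'
      (Finset.single_le_sum (f := T) (fun _ _ => Nat.zero_le _) (Finset.mem_univ j))
    rw [hk, Function.iterate_add_apply, hT, Function.iterate_fixed (CtrCfg.step_of_idle (hE j))]
  have := logStep_iterate (F := F) (x := x) (q := q) (p := p) (∑ i, T i) (L := L)
    (fun j => by rw [key]; exact hE j) hb
  simpa only [key] using this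

/-- The configuration in which the idle counters hold the bits `l`. -/
def logIdle (F : Set M.Q) (q : M.Q) (p : ℕ) (l : Fin M.m → List Bool) : (M.toLogTM F).Cfg :=
  logCfg F q p fun j => CtrCfg.idleOf (l j)

theorem actions_logIdle (q : M.Q) (p : ℕ) (l : Fin M.m → List Bool) :
    (M.toLogTM F).actions x (logIdle F q p l) =
      {a | ∃ r ∈ M.instr x ⟨q, p, fun j => CtrCfg.value (l j)⟩,
        a = ⟨(r.1, fun j => (CtrCfg.idleOf (l j)).phase.begin (r.2.2 j)), r.2.1,
          fun j => (CtrCfg.idleOf (l j)).tape 0, fun _ => .stay⟩} := by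
  simp only [TM.actions, toLogTM]
  exact if_pos fun _ => trivial

/-- One dispatching step moves the input head and starts the counter operations, leaving the tapes
unchanged; then all tapes run until idle. The length bound on the bit words is carried along
separately, since decrementing can leave leading zeros. -/
theorem logStep_simulates {c c' : M.Cfg} (h : M.BStep x c c') {l : Fin M.m → List Bool}
    (hv : ∀ j, CtrCfg.value (l j) = c.ctr j)
    (hl : ∀ j, (l j).length ≤ Nat.log 2 (x.length + 1) + 1) :
    ∃ l' : Fin M.m → List Bool, (∀ j, CtrCfg.value (l' j) = c'.ctr j) ∧
      (∀ j, (l' j).length ≤ Nat.log 2 (x.length + 1) + 1) ∧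
      ReflTransGen (LogStep F x (Nat.log 2 (x.length + 1) + 2)) (logIdle F c.state c.pos l)
        (logIdle F c'.state c'.pos l') := by
  obtain ⟨hs, hb⟩ := h
  obtain ⟨r, hr, rfl⟩ := Option.map_eq_some_iff.1 hs
  choose l' h1 h2 h3 using fun j => CtrCfg.run_begin (hl j) (r.2.2 j) (by
    rw [hv]; exact hb j)
  refine ⟨l', fun j => by rw [h1, hv]; rfl, h2, .head ⟨⟨⟨(r.1, fun j =>
    (CtrCfg.idleOf (l j)).phase.begin (r.2.2 j)), r.2.1, fun j => (CtrCfg.idleOf (l j)).tape 0,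
    fun _ => .stay⟩, ?_, ?_⟩, ?_⟩
    (logStep_run h3 (fun _ => trivial) fun _ => Nat.zero_le _)⟩
  · rw [actions_logIdle]
    exact ⟨r, by simp only [hv]; exact hr, rfl⟩
  · simp only [TM.applyAction, logIdle, logCfg, exec]
    congr 1
    funext j
    exact (Function.update_eq_self _ _).symm
  · exact fun j => Nat.zero_le _

theorem logStep_simulates_run {c : M.Cfg} (h : ReflTransGen (M.BStep x) M.initCfg c) :
    ∃ l : Fin M.m → List Bool, (∀ j, CtrCfg.value (l j) = c.ctr j) ∧
      (∀ j, (l j).length ≤ Nat.log 2 (x.length + 1) + 1) ∧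
      ReflTransGen (LogStep F x (Nat.log 2 (x.length + 1) + 2)) (M.toLogTM F).initCfg
        (logIdle F c.state c.pos l) := by
  induction h with
  | refl =>
    refine ⟨fun _ => [], fun _ => rfl, fun _ => Nat.zero_le _, ?_⟩
    refine logStep_run (L := fun _ => ⟨.blankTape, fun _ => .blank, 0⟩) (fun j => ?_)
      (fun _ => trivial) fun _ => Nat.zero_le _
    refine CtrCfg.Run.single ?_ (Nat.zero_le _)
    ext p
    · rfl
    · cases p <;> simp [CtrCfg.step, CtrPhase.act, CtrCfg.idleOf, CtrCfg.zip, CtrCfg.tapeOf]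
    · rfl
  | tail _ h ih =>
    obtain ⟨l, h1, h2, h3⟩ := ih
    obtain ⟨l', h1', h2', h3'⟩ := logStep_simulates h h1 h2
    exact ⟨l', h1', h2', h3.trans h3'⟩

/-- The simulated run ends in a halted configuration and the machine is deterministic, so every
reachable configuration lies on this run. Uniqueness of the result and the space bound both follow.
-/
theorem HaltsIn.toLogTM {q : M.Q} (h : M.HaltsIn x q) :
    (∃ t c, (M.toLogTM F).ReachesIn x t c ∧ (M.toLogTM F).Halted x c ∧ c.state.1 = q) ∧
    (∀ t c, (M.toLogTM F).ReachesIn x t c → (M.toLogTM F).Halted x c → c.state.1 = q) ∧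
    ∀ t c, (M.toLogTM F).ReachesIn x t c → ∀ j, c.head j ≤ Nat.log 2 (x.length + 1) + 2 := by
  obtain ⟨c, hc, hn, rfl⟩ := h
  obtain ⟨l, h1, -, h3⟩ := logStep_simulates_run (F := F) hc
  have hh : (M.toLogTM F).Halted x (logIdle F c.state c.pos l) := by
    have : M.instr x ⟨c.state, c.pos, fun j => CtrCfg.value (l j)⟩ = none := by
      simp only [h1]
      exact Option.map_eq_none_iff.1 hn
    rw [TM.Halted, actions_logIdle, this]
    simp
  have hns : ∀ d, ¬ (M.toLogTM F).Step x (logIdle F c.state c.pos l) d := by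
    rintro d ⟨a, ha, -⟩
    rw [show (M.toLogTM F).actions x _ = ∅ from hh] at ha
    exact ha
  have hdet := toLogTM_deterministic (M := M) (F := F)
  have hr : ReflTransGen ((M.toLogTM F).Step x) (M.toLogTM F).initCfg
      (logIdle F c.state c.pos l) := ReflTransGen.mono (fun _ _ h => h.1) _ _ h3
  refine ⟨?_, fun t d hd hdh => ?_, fun t d hd => ?_⟩
  · obtain ⟨t, ht⟩ := TM.exists_reachesIn_iff.2 hr
    exact ⟨t, _, ht, hh, rfl⟩
  · have := (reachable_of_maximal_run hdet.step_unique h3 hns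
      (TM.exists_reachesIn_iff.1 ⟨t, hd⟩)).2
    rcases ReflTransGen.cases_head this with rfl | ⟨e, ⟨⟨a, ha, -⟩, -⟩, -⟩
    · rfl
    · rw [show (M.toLogTM F).actions x _ = ∅ from hdh] at ha
      exact absurd ha (Set.notMem_empty _)
  · exact property_of_run (P := fun d : (M.toLogTM F).Cfg => ∀ j, d.head j ≤ _)
      (reachable_of_maximal_run hdet.step_unique h3 hns (TM.exists_reachesIn_iff.1 ⟨t, hd⟩)).1
      fun _ => Nat.zero_le _

/-- A problem solved by a halting counter automaton with small counters is in `L`. -/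
theorem inL_of_haltsIn (P : PromiseProblem) (M : CounterAutomaton P.Alphabet) (F : Set M.Q)
    (h : ∀ i, ∃ q, M.HaltsIn (P.encode i) q ∧ (i ∈ P.yes → q ∈ F) ∧ (i ∈ P.no → q ∉ F)) :
    P.InL := by
  -- Heads stay at most at `log (n + 1) + 2 ≤ log n + 3`, which is less than `4 * (log n + 1)`.
  refine ⟨M.toLogTM F, 4, toLogTM_deterministic, fun i => ?_, fun i t c hc j => ?_,
    fun i hi => ?_, fun i hi => ?_⟩
  all_goals obtain ⟨q, hq, hy, hno⟩ := h i
  all_goals obtain ⟨h1, h2, h3⟩ := hq.toLogTM (F := F)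
  · obtain ⟨t, c, hc, hh, -⟩ := h1
    exact ⟨t, c, hc, hh⟩
  · have := h3 t c hc j
    have hlog : Nat.log 2 ((P.encode i).length + 1) ≤ Nat.log 2 (P.encode i).length + 1 := by
      rcases Nat.eq_zero_or_pos (P.encode i).length with h0 | h0
      · simp [h0]
      · rw [← Nat.log_mul_base (by norm_num) h0.ne']
        exact Nat.log_mono_right (by omega)
    omega
  · obtain ⟨t, c, hc, hh, rfl⟩ := h1
    exact ⟨t, c, hc, hh, hy hi⟩
  · rintro ⟨t, c, hc, hh, ha⟩
    exact hno hi (h2 t c hc hh ▸ ha)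

end CounterAutomaton

namespace CounterAutomaton

variable {Γ : Type}

/-! ### The running time of a halting counter automaton -/

/-- The configuration after `t` steps. -/
def iter (M : CounterAutomaton Γ) (x : List Γ) : ℕ → M.Cfg → Option M.Cfg
  | 0, c => some c
  | t + 1, c => (M.iter x t c).bind (M.step x)

variable {M : CounterAutomaton Γ} {x : List Γ}

theorem iter_add (s t : ℕ) (c : M.Cfg) :
    M.iter x (s + t) c = (M.iter x s c).bind (M.iter x t) := by
  induction t with
  | zero => simp [iter]
  | succ t ih => rw [← Nat.add_assoc, iter, ih, Option.bind_assoc]; rfl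

theorem iter_pos_of_step_eq_none {c : M.Cfg} (h : M.step x c = none) {t : ℕ} (ht : 0 < t) :
    M.iter x t c = none := by
  obtain ⟨t, rfl⟩ := Nat.exists_eq_add_of_le ht
  rw [iter_add]
  simp [iter, h]

theorem pos_le_of_iter {t : ℕ} : ∀ {c : M.Cfg}, M.iter x t M.initCfg = some c →
    c.pos ≤ x.length + 1 := by
  induction t with
  | zero =>
    rintro c h
    obtain rfl := Option.some.inj h
    exact Nat.zero_le _
  | succ t ih =>
    intro c h
    obtain ⟨d, hd, hs⟩ := Option.bind_eq_some_iff.1 h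
    obtain ⟨r, -, rfl⟩ := Option.map_eq_some_iff.1 hs
    have := ih hd
    simp only [exec]
    cases r.2.1 <;> simp only [Move.input] <;> omega

theorem iter_of_run {c : M.Cfg} (h : ReflTransGen (M.BStep x) M.initCfg c) :
    ∃ T, M.iter x T M.initCfg = some c ∧
      ∀ t ≤ T, ∃ d, M.iter x t M.initCfg = some d ∧ ∀ j, d.ctr j ≤ x.length + 1 := by
  induction h with
  | refl =>
    refine ⟨0, rfl, fun t ht => ?_⟩
    obtain rfl := Nat.le_zero.1 ht
    exact ⟨_, rfl, fun j => Nat.zero_le _⟩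
  | @tail b c _ hs ih =>
    obtain ⟨T, hT, hb⟩ := ih
    have hc : M.iter x (T + 1) M.initCfg = some c := by simp [iter, hT, hs.1]
    refine ⟨T + 1, hc, fun t ht => ?_⟩
    rcases Nat.lt_or_eq_of_le ht with h | rfl
    · exact hb t (Nat.lt_succ_iff.1 h)
    · exact ⟨_, hc, hs.2⟩

/-- A halting deterministic run never repeats a configuration, and the configurations on it are
given by a state, a head position and `m` counter values, the last `m + 1` items having `n + 2`
possibilities each. -/
theorem HaltsIn.iter_bound {q : M.Q} (h : M.HaltsIn x q) {t : ℕ} {c : M.Cfg}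
    (ht : M.iter x t M.initCfg = some c) :
    t ≤ Nat.card M.Q * (x.length + 2) ^ (M.m + 1) := by
  obtain ⟨e, he, hn, -⟩ := h
  obtain ⟨T, hT, hb⟩ := iter_of_run he
  have htT : t ≤ T := by
    by_contra hlt
    obtain ⟨k, rfl⟩ := Nat.exists_eq_add_of_lt (not_le.1 hlt)
    rw [Nat.add_assoc, iter_add, hT, Option.bind_some, iter_pos_of_step_eq_none hn (by omega)] at ht
    cases ht
  choose d hd hc using fun i : Fin (T + 1) => hb i (Nat.lt_succ_iff.1 i.2)
  let f : Fin (T + 1) → M.Q × Fin (x.length + 2) × (Fin M.m → Fin (x.length + 2)) := fun i =>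
    ((d i).state, ⟨(d i).pos, Nat.lt_succ_iff.2 (pos_le_of_iter (hd i))⟩,
      fun j => ⟨(d i).ctr j, Nat.lt_succ_iff.2 (hc i j)⟩)
  -- Equal configurations at times `i < k` would need two different numbers of steps to reach the
  -- halting configuration `e`.
  have hne : ∀ i k : Fin (T + 1), i < k → d i ≠ d k := by
    intro i k hik hdd
    have hk : M.iter x (T - k) (d k) = some e := by
      have := iter_add (M := M) (x := x) k (T - k) M.initCfg
      rwa [Nat.add_sub_cancel' (Nat.lt_succ_iff.1 k.2), hT, hd k, Option.bind_some,
        eq_comm] at this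
    have hi : M.iter x (T - i) (d i) = some e := by
      have := iter_add (M := M) (x := x) i (T - i) M.initCfg
      rwa [Nat.add_sub_cancel' (Nat.lt_succ_iff.1 i.2), hT, hd i, Option.bind_some,
        eq_comm] at this
    have hki : T - i = (T - k) + (k - i : ℕ) := by
      have := k.2
      have : (i : ℕ) < k := hik
      omega
    rw [hki, iter_add, hdd, hk, Option.bind_some,
      iter_pos_of_step_eq_none hn (Nat.sub_pos_of_lt hik)] at hi
    cases hi
  have hf : Function.Injective f := by
    intro i k hik
    simp only [f, Prod.mk.injEq, Fin.mk.injEq] at hik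
    have hdd : d i = d k := by
      ext j
      · exact hik.1
      · exact hik.2.1
      · exact Fin.mk.inj (congrFun hik.2.2 j)
    rcases lt_trichotomy i k with h | h | h
    · exact absurd hdd (hne i k h)
    · exact h
    · exact absurd hdd.symm (hne k i h)
  have := Nat.card_le_card_of_injective f hf
  rw [Nat.card_prod, Nat.card_prod, Nat.card_fun, Nat.card_fin, Nat.card_fin, Nat.card_fin,
    ← pow_succ'] at this
  omega

end CounterAutomaton

/-! ### Guessing an annotation of the input -/

/-- The states of a machine that first guesses an annotation of the input. -/
inductive GuessState (Q : Type) : Type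
  | start : GuessState Q
  | copy : GuessState Q
  | rewind : GuessState Q
  | run (q : Q) : GuessState Q

instance GuessState.finite (Q : Type) [Finite Q] : Finite (GuessState Q) :=
  Finite.of_surjective (fun s : Fin 3 ⊕ Q => match s with
    | .inl i => ![start, copy, rewind] i
    | .inr q => run q) fun t => by
    cases t with
    | start => exact ⟨.inl 0, rfl⟩
    | copy => exact ⟨.inl 1, rfl⟩
    | rewind => exact ⟨.inl 2, rfl⟩
    | run q => exact ⟨.inr q, rfl⟩

instance InSym.finite (Γ : Type) [Finite Γ] : Finite (InSym Γ) :=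
  Finite.of_surjective (fun s : Bool ⊕ Γ => match s with
    | .inl b => if b then leftEnd else rightEnd
    | .inr g => sym g) fun t => by
    cases t with
    | leftEnd => exact ⟨.inl true, rfl⟩
    | rightEnd => exact ⟨.inl false, rfl⟩
    | sym g => exact ⟨.inr g, rfl⟩

def InSym.isLeftEnd {Γ : Type} : InSym Γ → Bool
  | leftEnd => true
  | _ => false

/-- A move that does not cross the right end marker. -/
def Move.clamp {Γ : Type} : InSym Γ → Move → Move
  | .rightEnd, .right => .stay
  | _, mv => mv

theorem readInput_of_lt {Γ : Type} {x : List Γ} {p : ℕ} (h : p < x.length) :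
    readInput x (p + 1) = .sym x[p] := by
  simp [readInput, h]

theorem readInput_of_ge {Γ : Type} {x : List Γ} {p : ℕ} (h : x.length ≤ p) :
    readInput x (p + 1) = .rightEnd := by
  simp [readInput, h]

theorem isLeftEnd_readInput {Γ : Type} (x : List Γ) (p : ℕ) :
    (readInput x p).isLeftEnd = decide (p = 0) := by
  cases p with
  | zero => rfl
  | succ p =>
    rcases Nat.lt_or_ge p x.length with h | h
    · simp [readInput_of_lt h, InSym.isLeftEnd]
    · simp [readInput_of_ge h, InSym.isLeftEnd]

/-- A work head is not stopped at the right end marker as the input head is; `clamp` imitates this,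
so the word on a work tape can play the role of an input. -/
theorem clamp_work_readInput {Γ : Type} (x : List Γ) {p : ℕ} (hp : p ≤ x.length + 1) (mv : Move) :
    (mv.clamp (readInput x p)).work p = mv.input x.length p := by
  cases p with
  | zero => cases mv <;> simp [readInput, Move.clamp, Move.work, Move.input]
  | succ p =>
    rcases Nat.lt_or_ge p x.length with h | h
    · rw [readInput_of_lt h]
      cases mv <;> simp [Move.clamp, Move.work, Move.input]
      omega
    · rw [readInput_of_ge h]
      cases mv <;> simp [Move.clamp, Move.work, Move.input]
      omega

/-- All cells from `x.length + 1` on read as the right end marker, so writing a letter into the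
first of them appends it to the word. -/
theorem update_readInput {Γ : Type} (x : List Γ) (g : Γ) :
    Function.update (readInput x) (x.length + 1) (.sym g) = readInput (x ++ [g]) := by
  funext p
  cases p with
  | zero => rfl
  | succ p =>
    rcases lt_trichotomy p x.length with h | rfl | h
    · rw [Function.update_of_ne (by omega)]
      simp [readInput, List.getElem?_append_left h]
    · simp [readInput]
    · rw [Function.update_of_ne (by omega), readInput_of_ge h.le, readInput_of_ge (by simp; omega)]

namespace CounterAutomaton

variable {Γ D : Type} [Finite Γ] [Finite D]

/-- The nondeterministic Turing machine that writes a guessed annotation of its input on work tape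
`0` and runs the counter automaton on it, using the head positions on the other tapes as
counters. -/
def toGuessTM (M : CounterAutomaton (Γ × D)) (F : Set M.Q) : TM Γ where
  Q := GuessState M.Q
  S := InSym (Γ × D)
  k := M.m + 1
  -- With this blank, a word written after a left end marker is a correctly delimited input at every
  -- moment. On the other tapes only cell `0` holds a left end marker, so reading it is the zero
  -- test for the head position.
  blank := .rightEnd
  start := .start
  accepting := {q | ∃ q' ∈ F, q = .run q'}
  δ := fun q i w => match q with
    | .start => {⟨.copy, .right, fun _ => .leftEnd, Fin.cons .right fun _ => .stay⟩}
    | .copy => match i with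
      | .leftEnd => ∅
      | .sym g => {a | ∃ d, a = ⟨.copy, .right, Fin.cons (.sym (g, d)) (Fin.tail w),
          Fin.cons .right fun _ => .stay⟩}
      | .rightEnd => {⟨.rewind, .stay, w, Fin.cons .stay fun _ => .stay⟩}
    | .rewind =>
      if (w 0).isLeftEnd then {⟨.run M.start, .stay, w, Fin.cons .stay fun _ => .stay⟩}
      else {⟨.rewind, .stay, w, Fin.cons .left fun _ => .stay⟩}
    | .run q => {a | ∃ r ∈ M.δ q (w 0) (fun j => (w j.succ).isLeftEnd),
        a = ⟨.run r.1, .stay, w, Fin.cons (r.2.1.clamp (w 0)) r.2.2⟩}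

variable {M : CounterAutomaton (Γ × D)} {F : Set M.Q} {x : List Γ}

/-- The configuration with the annotated word `y` on work tape `0`, whose head is in cell `h`, and
with counters `c`. -/
def guessCfg (F : Set M.Q) (q : GuessState M.Q) (p : ℕ) (y : List (Γ × D)) (h : ℕ)
    (c : Fin M.m → ℕ) : (M.toGuessTM F).Cfg where
  state := q
  inHead := p
  tape := Fin.cons (α := fun _ => ℕ → InSym (Γ × D)) (readInput y) fun _ => readInput []
  head := Fin.cons (α := fun _ => ℕ) h c

/-- The symbols under the work heads. -/
def guessRead (M : CounterAutomaton (Γ × D)) (y : List (Γ × D)) (h : ℕ) (c : Fin M.m → ℕ) :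
    Fin (M.m + 1) → InSym (Γ × D) :=
  Fin.cons (readInput y h) fun j => readInput [] (c j)

theorem tape_head_guessCfg (q : GuessState M.Q) (p : ℕ) (y : List (Γ × D)) (h : ℕ)
    (c : Fin M.m → ℕ) :
    (fun j => (guessCfg F q p y h c).tape j ((guessCfg F q p y h c).head j)) =
      guessRead M y h c := by
  funext j
  refine Fin.cases ?_ (fun j => ?_) j <;> rfl

theorem actions_guessCfg (q : GuessState M.Q) (p : ℕ) (y : List (Γ × D)) (h : ℕ)
    (c : Fin M.m → ℕ) : (M.toGuessTM F).actions x (guessCfg F q p y h c) =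
      (M.toGuessTM F).δ q (readInput x p) (guessRead M y h c) := by
  rw [TM.actions, tape_head_guessCfg]
  rfl

/-- The action with the given components. -/
def guessAct (F : Set M.Q) (q : GuessState M.Q) (mi : Move) (w : Fin (M.m + 1) → InSym (Γ × D))
    (mv : Move) (cm : Fin M.m → Move) :
    Action (M.toGuessTM F).Q (M.toGuessTM F).S (M.toGuessTM F).k :=
  ⟨q, mi, w, Fin.cons (α := fun _ => Move) mv cm⟩

theorem applyAction_guessCfg (q q' : GuessState M.Q) (p : ℕ) (y : List (Γ × D)) (h : ℕ)
    (c : Fin M.m → ℕ) (mi mv : Move) (cm : Fin M.m → Move) :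
    (M.toGuessTM F).applyAction x (guessCfg F q p y h c)
        (guessAct F q' mi (guessRead M y h c) mv cm) =
      guessCfg F q' (mi.input x.length p) y (mv.work h) fun j => (cm j).work (c j) := by
  simp only [TM.applyAction, guessCfg, guessAct]
  congr 1
  · funext j
    refine Fin.cases ?_ (fun j => ?_) j <;> exact Function.update_eq_self _ _
  · funext j
    refine Fin.cases ?_ (fun j => ?_) j <;> rfl

theorem applyAction_copy (y : List (Γ × D)) (b : Γ × D) (c : Fin M.m → ℕ) (p : ℕ) :
    (M.toGuessTM F).applyAction x (guessCfg F .copy p y (y.length + 1) c)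
        (guessAct F .copy .right
          (Fin.cons (.sym b) (Fin.tail (guessRead M y (y.length + 1) c))) .right fun _ => .stay) =
      guessCfg F .copy (Move.right.input x.length p) (y ++ [b]) ((y ++ [b]).length + 1) c := by
  simp only [TM.applyAction, guessCfg, guessAct]
  congr 1
  · funext j
    refine Fin.cases ?_ (fun j => ?_) j
    · exact update_readInput y b
    · exact Function.update_eq_self _ _
  · funext j
    refine Fin.cases ?_ (fun j => ?_) j
    · simp [Move.work]
    · rfl

theorem applyAction_start :
    (M.toGuessTM F).applyAction x (M.toGuessTM F).initCfg
        (guessAct F .copy .right (fun _ => .leftEnd) .right fun _ => .stay) =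
      guessCfg F .copy 1 [] 1 fun _ => 0 := by
  simp only [TM.applyAction, guessCfg, TM.initCfg, guessAct]
  congr 1
  · funext j p
    refine Fin.cases ?_ (fun j => ?_) j <;> cases p <;> rfl
  · funext j
    refine Fin.cases ?_ (fun j => ?_) j <;> rfl

theorem step_init_iff {c' : (M.toGuessTM F).Cfg} :
    (M.toGuessTM F).Step x (M.toGuessTM F).initCfg c' ↔
      c' = guessCfg F .copy 1 [] 1 fun _ => 0 := by
  have ha : (M.toGuessTM F).actions x (M.toGuessTM F).initCfg =
      {guessAct F .copy .right (fun _ => .leftEnd) .right fun _ => .stay} := rfl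
  simp only [TM.Step, ha, Set.mem_singleton_iff, exists_eq_left, applyAction_start]

theorem step_copy_iff {y : List (Γ × D)} {c : Fin M.m → ℕ} {p : ℕ} {g : Γ}
    (hx : readInput x p = .sym g) {c' : (M.toGuessTM F).Cfg} :
    (M.toGuessTM F).Step x (guessCfg F .copy p y (y.length + 1) c) c' ↔ ∃ d, c' =
      guessCfg F .copy (Move.right.input x.length p) (y ++ [(g, d)])
        ((y ++ [(g, d)]).length + 1) c := by
  have ha : (M.toGuessTM F).actions x (guessCfg F .copy p y (y.length + 1) c) =
      {a | ∃ d, a = guessAct F .copy .right (Fin.cons (.sym (g, d))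
        (Fin.tail (guessRead M y (y.length + 1) c))) .right fun _ => .stay} := by
    rw [actions_guessCfg, hx]
    rfl
  simp only [TM.Step, ha, Set.mem_ofPred_eq, ← applyAction_copy]
  constructor
  · rintro ⟨_, ⟨d, rfl⟩, h⟩
    exact ⟨d, h⟩
  · rintro ⟨d, h⟩
    exact ⟨_, ⟨d, rfl⟩, h⟩

theorem step_copy_end_iff {y : List (Γ × D)} {c : Fin M.m → ℕ} {p h : ℕ}
    (hx : readInput x p = .rightEnd) {c' : (M.toGuessTM F).Cfg} :
    (M.toGuessTM F).Step x (guessCfg F .copy p y h c) c' ↔ c' = guessCfg F .rewind p y h c := by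
  have ha : (M.toGuessTM F).actions x (guessCfg F .copy p y h c) =
      {guessAct F .rewind .stay (guessRead M y h c) .stay fun _ => .stay} := by
    rw [actions_guessCfg, hx]
    rfl
  simp only [TM.Step, ha, Set.mem_singleton_iff, exists_eq_left, applyAction_guessCfg]
  rfl

theorem step_rewind_zero_iff {y : List (Γ × D)} {c : Fin M.m → ℕ} {p : ℕ}
    {c' : (M.toGuessTM F).Cfg} :
    (M.toGuessTM F).Step x (guessCfg F .rewind p y 0 c) c' ↔
      c' = guessCfg F (.run M.start) p y 0 c := by
  have ha : (M.toGuessTM F).actions x (guessCfg F .rewind p y 0 c) =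
      {guessAct F (.run M.start) .stay (guessRead M y 0 c) .stay fun _ => .stay} := by
    rw [actions_guessCfg]
    rfl
  simp only [TM.Step, ha, Set.mem_singleton_iff, exists_eq_left, applyAction_guessCfg]
  rfl

theorem step_rewind_succ_iff {y : List (Γ × D)} {c : Fin M.m → ℕ} {p h : ℕ}
    {c' : (M.toGuessTM F).Cfg} :
    (M.toGuessTM F).Step x (guessCfg F .rewind p y (h + 1) c) c' ↔
      c' = guessCfg F .rewind p y h c := by
  have ha : (M.toGuessTM F).actions x (guessCfg F .rewind p y (h + 1) c) =
      {guessAct F .rewind .stay (guessRead M y (h + 1) c) .left fun _ => .stay} := by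
    rw [actions_guessCfg]
    exact if_neg (by
      rw [show guessRead M y (h + 1) c 0 = readInput y (h + 1) from rfl, isLeftEnd_readInput]
      simp)
  simp only [TM.Step, ha, Set.mem_singleton_iff, exists_eq_left, applyAction_guessCfg]
  rfl

theorem actions_run (c : M.Cfg) (p : ℕ) (y : List (Γ × D)) :
    (M.toGuessTM F).actions x (guessCfg F (.run c.state) p y c.pos c.ctr) =
      {a | ∃ r ∈ M.instr y c, a = guessAct F (.run r.1) .stay (guessRead M y c.pos c.ctr)
        (r.2.1.clamp (readInput y c.pos)) r.2.2} := by
  have h : M.δ c.state (guessRead M y c.pos c.ctr 0)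
      (fun j => (guessRead M y c.pos c.ctr j.succ).isLeftEnd) = M.instr y c := by
    simp only [instr, guessRead, Fin.cons_zero, Fin.cons_succ, isLeftEnd_readInput]
  rw [actions_guessCfg, ← h]
  rfl

/-- The configuration that represents a configuration of the counter automaton. -/
def runCfg (F : Set M.Q) (p : ℕ) (y : List (Γ × D)) (c : M.Cfg) : (M.toGuessTM F).Cfg :=
  guessCfg F (.run c.state) p y c.pos c.ctr

theorem step_run_iff {y : List (Γ × D)} {c : M.Cfg} (hc : c.pos ≤ y.length + 1) {p : ℕ}
    {c' : (M.toGuessTM F).Cfg} :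
    (M.toGuessTM F).Step x (runCfg F p y c) c' ↔ ∃ e ∈ M.step y c, c' = runCfg F p y e := by
  have h1 : ∀ r : M.Q × Move × (Fin M.m → Move),
      (M.toGuessTM F).applyAction x (runCfg F p y c) (guessAct F (.run r.1) .stay
        (guessRead M y c.pos c.ctr) (r.2.1.clamp (readInput y c.pos)) r.2.2) =
      runCfg F p y (M.exec y c r) := by
    intro r
    rw [runCfg, applyAction_guessCfg, clamp_work_readInput y hc]
    rfl
  simp only [TM.Step, runCfg, actions_run, Set.mem_ofPred_eq]
  constructor
  · rintro ⟨_, ⟨r, hr, rfl⟩, rfl⟩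
    exact ⟨M.exec y c r, Option.mem_map_of_mem _ hr, h1 r⟩
  · rintro ⟨e, he, rfl⟩
    obtain ⟨r, hr, rfl⟩ := Option.map_eq_some_iff.1 he
    exact ⟨_, ⟨r, hr, rfl⟩, (h1 r).symm⟩

/-- The reachable configurations of the guessing machine. -/
inductive GuessInv (F : Set M.Q) (x : List Γ) : ℕ → (M.toGuessTM F).Cfg → Prop
  | initial : GuessInv F x 0 (M.toGuessTM F).initCfg
  | copy (y : List (Γ × D)) (z : List Γ) (h : y.map Prod.fst ++ z = x) :
      GuessInv F x (y.length + 1)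
        (guessCfg F .copy (y.length + 1) y (y.length + 1) fun _ => 0)
  | rewind (y : List (Γ × D)) (h : y.map Prod.fst = x) (k l : ℕ) (hl : k + l = x.length + 1) :
      GuessInv F x (x.length + 2 + k) (guessCfg F .rewind (x.length + 1) y l fun _ => 0)
  -- The preparation takes one initial step, `|x|` copying steps, one step at the right end, `|x| +
  -- 1` steps back and one step to start the automaton.
  | run (y : List (Γ × D)) (h : y.map Prod.fst = x) (t : ℕ) (c : M.Cfg)
      (ht : M.iter y t M.initCfg = some c) :
      GuessInv F x (2 * x.length + 4 + t) (runCfg F (x.length + 1) y c)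

theorem GuessInv.step {t : ℕ} {c c' : (M.toGuessTM F).Cfg} (h : GuessInv F x t c)
    (hs : (M.toGuessTM F).Step x c c') : GuessInv F x (t + 1) c' := by
  cases h with
  | initial =>
    rw [step_init_iff] at hs
    rw [hs]
    exact .copy [] x rfl
  | copy y z h =>
    cases z with
    | nil =>
      rw [List.append_nil] at h
      have hl : y.length = x.length := by rw [← h, List.length_map]
      rw [step_copy_end_iff (readInput_of_ge hl.ge)] at hs
      rw [hs, hl]
      exact .rewind y h 0 (x.length + 1) (Nat.zero_add _)
    | cons g z =>
      have hx : readInput x (y.length + 1) = .sym g := by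
        rw [readInput_of_lt (by simp [← h])]
        simp [← h]
      obtain ⟨d, rfl⟩ := (step_copy_iff hx).1 hs
      have := GuessInv.copy (F := F) (y ++ [(g, d)]) z (by simpa using h)
      have hlen : Move.right.input x.length (y.length + 1) = (y ++ [(g, d)]).length + 1 := by
        simp [← h, Move.input]
      rw [hlen]
      simpa using this
  | rewind y h k l hl =>
    cases l with
    | zero =>
      rw [step_rewind_zero_iff] at hs
      have ht : x.length + 2 + k + 1 = 2 * x.length + 4 + 0 := by omega
      rw [hs, ht]
      exact .run y h 0 M.initCfg rfl
    | succ l =>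
      rw [step_rewind_succ_iff] at hs
      rw [hs]
      exact .rewind y h (k + 1) l (by omega)
  | run y h t c ht =>
    obtain ⟨e, he, rfl⟩ := (step_run_iff (pos_le_of_iter ht)).1 hs
    exact .run y h (t + 1) e (by simpa [iter, ht] using he)

theorem guessInv_of_reachesIn {t : ℕ} : ∀ {c : (M.toGuessTM F).Cfg},
    (M.toGuessTM F).ReachesIn x t c → GuessInv F x t c := by
  induction t with
  | zero =>
    rintro c h
    rw [show c = _ from h]
    exact .initial
  | succ t ih =>
    rintro c ⟨c', h', hs⟩
    exact (ih h').step hs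

theorem reaches_copy (y : List (Γ × D)) : ∀ z : List Γ, y.map Prod.fst ++ z = x →
    ReflTransGen ((M.toGuessTM F).Step x) (M.toGuessTM F).initCfg
      (guessCfg F .copy (y.length + 1) y (y.length + 1) fun _ => 0) := by
  induction y using List.reverseRecOn with
  | nil => exact fun _ _ => .single (step_init_iff.2 rfl)
  | append_singleton y b ih =>
    intro z h
    rw [List.map_append, List.append_assoc] at h
    refine (ih _ h).tail ((step_copy_iff (g := b.1) ?_).2 ⟨b.2, ?_⟩)
    · rw [readInput_of_lt (by simp [← h])]
      simp [← h]
    · have hlen : Move.right.input x.length (y.length + 1) = (y ++ [b]).length + 1 := by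
        simp [← h, Move.input]
      rw [hlen]

theorem reaches_run {y : List (Γ × D)} (h : y.map Prod.fst = x) {t : ℕ} : ∀ {c : M.Cfg},
    M.iter y t M.initCfg = some c →
    ReflTransGen ((M.toGuessTM F).Step x) (M.toGuessTM F).initCfg
      (runCfg F (x.length + 1) y c) := by
  induction t with
  | zero =>
    intro c hc
    obtain rfl := Option.some.inj hc
    have hl : y.length = x.length := by rw [← h, List.length_map]
    have h1 := (reaches_copy (M := M) (F := F) y [] (by simpa using h)).tail
      ((step_copy_end_iff (readInput_of_ge hl.ge)).2 rfl)
    have h2 : ∀ k, ReflTransGen ((M.toGuessTM F).Step x)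
        (guessCfg F .rewind (x.length + 1) y k fun _ => 0)
        (guessCfg F .rewind (x.length + 1) y 0 fun _ => 0) := by
      intro k
      induction k with
      | zero => exact .refl
      | succ k ih => exact .head (step_rewind_succ_iff.2 rfl) ih
    rw [hl] at h1
    exact (h1.trans (h2 _)).tail (step_rewind_zero_iff.2 rfl)
  | succ t ih =>
    intro c hc
    obtain ⟨d, hd, hs⟩ := Option.bind_eq_some_iff.1 hc
    exact (ih hd).tail ((step_run_iff (pos_le_of_iter hd)).2 ⟨c, hs, rfl⟩)

/-- A problem is in `NP` if the instances with a suitable annotation can be recognized by a halting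
counter automaton with small counters. -/
theorem inNP_of_haltsIn (P : PromiseProblem) {D : Type} [Finite D]
    (M : CounterAutomaton (P.Alphabet × D)) (F : Set M.Q)
    (hh : ∀ i, ∀ y : List (P.Alphabet × D), y.map Prod.fst = P.encode i →
      ∃ q, M.HaltsIn y q ∧ (i ∈ P.no → q ∉ F))
    (hy : ∀ i ∈ P.yes, ∃ y : List (P.Alphabet × D), y.map Prod.fst = P.encode i ∧
      ∃ q ∈ F, M.HaltsIn y q) : P.InNP := by
  have := P.finiteAlphabet
  refine ⟨M.toGuessTM F, 2 * .X + 4 + .C (Nat.card M.Q) * (.X + 2) ^ (M.m + 1),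
    fun i t c hc => ?_, fun i hi => ?_, fun i hi => ?_⟩
  · simp only [Polynomial.eval_add, Polynomial.eval_mul, Polynomial.eval_pow, Polynomial.eval_X,
      Polynomial.eval_C, Polynomial.eval_ofNat]
    cases guessInv_of_reachesIn hc with
    | initial => exact Nat.zero_le _
    | copy y z h =>
      have : y.length ≤ (P.encode i).length := by simp [← h]
      omega
    | rewind y h k l hl => omega
    | run y h t c ht =>
      obtain ⟨q, hq, -⟩ := hh i y h
      have := hq.iter_bound ht
      rw [show y.length = (P.encode i).length by rw [← h, List.length_map]] at this
      omega
  · obtain ⟨y, h, q, hq, e, he, hs, rfl⟩ := hy i hi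
    obtain ⟨T, hT, -⟩ := iter_of_run he
    obtain ⟨t, ht⟩ := TM.exists_reachesIn_iff.2 (reaches_run (F := F) h hT)
    refine ⟨t, _, ht, ?_, e.state, hq, rfl⟩
    rw [TM.Halted, runCfg, actions_run, Option.map_eq_none_iff.1 hs]
    simp
  · rintro ⟨t, c, hc, hhalt, q, hq, hcq⟩
    have hrun := guessInv_of_reachesIn hc
    cases hrun with
    | initial => cases hcq
    | copy y z h => cases hcq
    | rewind y h k l hl => cases hcq
    | run y h t c ht =>
      obtain rfl : c.state = q := GuessState.run.inj hcq
      obtain ⟨q', ⟨e, he, hs, rfl⟩, hn⟩ := hh i y h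
      obtain ⟨T, hT, -⟩ := iter_of_run he
      have hcn : M.step y c = none := by
        rw [TM.Halted, runCfg, actions_run] at hhalt
        rw [step, Option.map_eq_none_iff, Option.eq_none_iff_forall_not_mem]
        intro r hr
        exact (Set.eq_empty_iff_forall_notMem.1 hhalt) _ ⟨r, hr, rfl⟩
      -- Neither `e` nor `c` has a successor, and both lie on the same deterministic run on `y`.
      have hTt : T = t := by
        rcases lt_trichotomy T t with hlt | h | hlt
        · obtain ⟨k, rfl⟩ := Nat.exists_eq_add_of_lt hlt
          rw [Nat.add_assoc, iter_add, hT, Option.bind_some,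
            iter_pos_of_step_eq_none hs (by omega)] at ht
          cases ht
        · exact h
        · obtain ⟨k, rfl⟩ := Nat.exists_eq_add_of_lt hlt
          rw [Nat.add_assoc, iter_add, ht, Option.bind_some,
            iter_pos_of_step_eq_none hcn (by omega)] at hT
          cases hT
      obtain rfl : e = c := by
        rw [hTt, ht] at hT
        exact (Option.some.inj hT).symm
      exact hn hi hq

end CounterAutomaton

/-! ### A counter automaton evaluating formulas -/

/-- Truth of a formula that is written from position `p` on, where an existential (universal)
quantifier written at position `q` assigns the value `ge q` (`ga q`) to its variable. -/
def Fml.EvalAt {σ : Signature} (A : RelStr σ) (ge ga : ℕ → A.carrier) :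
    Fml σ → (ℕ → A.carrier) → ℕ → Prop
  | atom R v, s, _ => (fun i => s (v i)) ∈ A.rel R
  | and φ ψ, s, p => EvalAt A ge ga φ s (p + 1) ∧ EvalAt A ge ga ψ s (p + 1 + φ.encode.length + 1)
  | or φ ψ, s, p => EvalAt A ge ga φ s (p + 1) ∨ EvalAt A ge ga ψ s (p + 1 + φ.encode.length + 1)
  | ex x φ, s, p => EvalAt A ge ga φ (Function.update s x (ge p)) (p + 1 + (encodeVar σ x).length)
  | all x φ, s, p => EvalAt A ge ga φ (Function.update s x (ga p)) (p + 1 + (encodeVar σ x).length)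

/-- How letters of an annotated word are read: as tokens, and as values for the variable of a
quantifier. -/
structure Reading {σ : Signature} (A : RelStr σ) (Γ : Type) where
  tok : Γ → Token σ
  exVal : Γ → A.carrier
  allVal : Γ → A.carrier

/-- An atom that is being evaluated: the argument to be looked up next, and the values of the
arguments, correct for those looked up before. -/
abbrev AtomState {σ : Signature} (A : RelStr σ) : Type :=
  Σ R : σ.Sym, Fin (σ.arity R) × (Fin (σ.arity R) → A.carrier)

/-- The states of the evaluating automaton. -/
inductive EvalState {σ : Signature} (A : RelStr σ) : Type
  /-- at the first token of a formula -/
  | eval : EvalState A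
  /-- in the variable of a quantifier -/
  | qvar : EvalState A
  /-- right after a formula with truth value `b` -/
  | ret (b : Bool) : EvalState A
  /-- in a right subformula that is irrelevant -/
  | skip (b : Bool) : EvalState A
  /-- on the way to the left, in search of the quantifier that binds an argument -/
  | look (c : AtomState A) : EvalState A
  /-- at a letter of the variable of a quantifier, to be compared with the argument -/
  | cmp (c : AtomState A) (d : A.carrier) : EvalState A
  /-- on the way to the argument, with the letter that was read -/
  | fwd (c : AtomState A) (d : A.carrier) (t : Option Bool) : EvalState A
  /-- on the way back to the quantifier; `none` after a mismatch -/
  | bwd (c : AtomState A) (o : Option A.carrier) : EvalState A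
  /-- back to the symbol of a quantifier for another variable -/
  | toQ (c : AtomState A) : EvalState A
  /-- the value `d` of the argument is found -/
  | clear (c : AtomState A) (d : A.carrier) : EvalState A

instance EvalState.finite {σ : Signature} (A : RelStr σ) : Finite (EvalState A) :=
  Finite.of_surjective (fun s : Fin 2 ⊕ Bool ⊕ Bool ⊕ AtomState A ⊕ (AtomState A × A.carrier) ⊕
      (AtomState A × A.carrier × Option Bool) ⊕ (AtomState A × Option A.carrier) ⊕ AtomState A ⊕
      (AtomState A × A.carrier) => match s with
    | .inl i => ![eval, qvar] i
    | .inr (.inl b) => ret b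
    | .inr (.inr (.inl b)) => skip b
    | .inr (.inr (.inr (.inl c))) => look c
    | .inr (.inr (.inr (.inr (.inl c)))) => cmp c.1 c.2
    | .inr (.inr (.inr (.inr (.inr (.inl c))))) => fwd c.1 c.2.1 c.2.2
    | .inr (.inr (.inr (.inr (.inr (.inr (.inl c)))))) => bwd c.1 c.2
    | .inr (.inr (.inr (.inr (.inr (.inr (.inr (.inl c))))))) => toQ c
    | .inr (.inr (.inr (.inr (.inr (.inr (.inr (.inr c))))))) => clear c.1 c.2) fun t => by
    cases t with
    | eval => exact ⟨.inl 0, rfl⟩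
    | qvar => exact ⟨.inl 1, rfl⟩
    | ret b => exact ⟨.inr (.inl b), rfl⟩
    | skip b => exact ⟨.inr (.inr (.inl b)), rfl⟩
    | look c => exact ⟨.inr (.inr (.inr (.inl c))), rfl⟩
    | cmp c d => exact ⟨.inr (.inr (.inr (.inr (.inl (c, d))))), rfl⟩
    | fwd c d t => exact ⟨.inr (.inr (.inr (.inr (.inr (.inl (c, d, t)))))), rfl⟩
    | bwd c o => exact ⟨.inr (.inr (.inr (.inr (.inr (.inr (.inl (c, o))))))), rfl⟩
    | toQ c => exact ⟨.inr (.inr (.inr (.inr (.inr (.inr (.inr (.inl c))))))), rfl⟩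
    | clear c d => exact ⟨.inr (.inr (.inr (.inr (.inr (.inr (.inr (.inr (c, d)))))))), rfl⟩

namespace EvalState

variable {σ : Signature} {A : RelStr σ} {Γ : Type}

/-- The instruction with next state `q`, head move `m` and counter operations `x`, `y`, `z`. -/
def ins (q : EvalState A) (m x y z : Move) : Option (EvalState A × Move × (Fin 3 → Move)) :=
  some (q, m, ![x, y, z])

/-- The state in which the evaluation of an atom starts. -/
noncomputable def start (A : RelStr σ) (R : σ.Sym) : EvalState A :=
  look ⟨R, ⟨0, σ.arity_pos R⟩, fun _ => Classical.arbitrary A.carrier⟩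

open Classical in
/-- What to do when the value of an argument is found. -/
noncomputable def next (c : AtomState A) (d : A.carrier) :
    Option (EvalState A × Move × (Fin 3 → Move)) :=
  if h : (c.2.1 : ℕ) + 1 < σ.arity c.1 then
    ins (look ⟨c.1, ⟨c.2.1 + 1, h⟩, Function.update c.2.2 c.2.1 d⟩) .stay .stay .stay .stay
  else
    ins (ret (decide (Function.update c.2.2 c.2.1 d ∈ A.rel c.1))) .right .stay .stay .stay

/-- The transition function. The first counter holds a number of unmatched parentheses. During the
evaluation of an atom, the sum of the second and the third one is the distance from the
argument. -/
noncomputable def trans (T : Reading A Γ) (q : EvalState A) (s : InSym Γ) (z : Fin 3 → Bool) :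
    Option (EvalState A × Move × (Fin 3 → Move)) :=
  match q with
  | eval => match s with
    | .leftEnd => ins eval .right .stay .stay .stay
    | .rightEnd => none
    | .sym g => match T.tok g with
      | .lparen => ins eval .right .stay .stay .stay
      | .ex => ins qvar .right .stay .stay .stay
      | .all => ins qvar .right .stay .stay .stay
      | .rel R => ins (start A R) .stay .stay .stay .stay
      | _ => none
  | qvar => match s with
    | .sym g => match T.tok g with
      | .comma => ins eval .right .stay .stay .stay
      | _ => ins qvar .right .stay .stay .stay
    | _ => none
  | ret b => match s with
    | .sym g => match T.tok g with
      | .rparen => ins (ret b) .right .stay .stay .stay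
      | .and => ins (if b then eval else skip b) .right .stay .stay .stay
      | .or => ins (if b then skip b else eval) .right .stay .stay .stay
      | _ => none
    | _ => none
  -- The first counter counts parentheses opened while skipping, so a closing one met at zero
  -- belongs to the connective whose right operand is skipped.
  | skip b => match s with
    | .sym g => match T.tok g with
      | .lparen => ins (skip b) .right .right .stay .stay
      | .rparen => ins (if z 0 then ret b else skip b) .right .left .stay .stay
      | _ => ins (skip b) .right .stay .stay .stay
    | _ => none
  -- A connective met on the way left means that the head was in a right operand. The counter is
  -- raised until the matching opening parenthesis, so that quantifiers in the left operand, which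
  -- do not bind here, are ignored. An opening parenthesis met at zero is left from its left
  -- operand; the truncated decrement has no effect there.
  | look c => match s with
    | .sym g => match T.tok g with
      | .and => ins (look c) .left .right .right .stay
      | .or => ins (look c) .left .right .right .stay
      | .lparen => ins (look c) .left .left .right .stay
      | .ex => if z 0 then ins (cmp c (T.exVal g)) .right .stay .stay .stay
          else ins (look c) .left .stay .right .stay
      | .all => if z 0 then ins (cmp c (T.allVal g)) .right .stay .stay .stay
          else ins (look c) .left .stay .right .stay
      | _ => ins (look c) .left .stay .right .stay
    | _ => none
  | cmp c d => match s with
    | .sym g => match T.tok g with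
      | .bit b => ins (fwd c d (some b)) .stay .stay .stay .stay
      | .comma => ins (fwd c d none) .stay .stay .stay .stay
      | _ => none
    | _ => none
  -- The second counter is the remaining distance to the letter of the argument, the third the
  -- distance already walked; `bwd` reverses the exchange. Both names advance in step, so the total
  -- distance is the same for every pair of letters.
  | fwd c d t =>
    if z 1 then match s with
      | .sym g => match T.tok g, t with
        | .bit b, some b' => ins (bwd c (if b = b' then some d else none)) .stay .stay .stay .stay
        | .comma, none => ins (clear c d) .stay .stay .stay .stay
        | _, _ => ins (bwd c none) .stay .stay .stay .stay
      | _ => none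
    else ins (fwd c d t) .right .stay .left .right
  | bwd c o =>
    if z 2 then match o with
      | some d => ins (cmp c d) .right .stay .stay .stay
      | none => ins (toQ c) .stay .stay .stay .stay
    else ins (bwd c o) .left .stay .right .left
  | toQ c => match s with
    | .sym g => match T.tok g with
      | .ex => ins (look c) .left .stay .right .stay
      | .all => ins (look c) .left .stay .right .stay
      | _ => ins (toQ c) .left .stay .stay .stay
    | _ => none
  | clear c d =>
    if z 2 then next c d else ins (clear c d) .stay .stay .stay .left

end EvalState

/-- The automaton that evaluates an annotated formula from left to right. -/
noncomputable def evalAutomaton {σ : Signature} {A : RelStr σ} {Γ : Type} (T : Reading A Γ) :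
    CounterAutomaton Γ where
  Q := EvalState A
  m := 3
  start := .eval
  δ := EvalState.trans T

/-! ### Runs of the evaluating automaton -/

namespace Reading

variable {σ : Signature} {A : RelStr σ} {Γ : Type} (T : Reading A Γ) (w : List Γ)

/-- The token `t` is written at position `p`. -/
def TokAt (p : ℕ) (t : Token σ) : Prop := ∃ g, readInput w p = .sym g ∧ T.tok g = t

/-- The tokens `l` are written from position `p` on. -/
def Seg : ℕ → List (Token σ) → Prop
  | _, [] => True
  | p, t :: l => T.TokAt w p t ∧ Seg (p + 1) l

def cfg (q : EvalState A) (p a b c : ℕ) : (evalAutomaton T).Cfg := ⟨q, p, ![a, b, c]⟩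

def Run : (evalAutomaton T).Cfg → (evalAutomaton T).Cfg → Prop :=
  ReflTransGen ((evalAutomaton T).BStep w)

variable {T w}

theorem sym_pos_bounds {p : ℕ} {g : Γ} (h : readInput w p = .sym g) : 1 ≤ p ∧ p ≤ w.length := by
  cases p with
  | zero => cases h
  | succ p =>
    refine ⟨by omega, ?_⟩
    by_contra hp
    rw [readInput_of_ge (by omega)] at h
    cases h

theorem TokAt.bounds {p : ℕ} {t : Token σ} (h : T.TokAt w p t) : 1 ≤ p ∧ p ≤ w.length :=
  sym_pos_bounds h.choose_spec.1

theorem seg_append {p : ℕ} {l m : List (Token σ)} :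
    T.Seg w p (l ++ m) ↔ T.Seg w p l ∧ T.Seg w (p + l.length) m := by
  induction l generalizing p with
  | nil => simp [Seg]
  | cons t l ih =>
    rw [List.cons_append, Seg, Seg, ih, and_assoc, List.length_cons, Nat.add_assoc p 1,
      Nat.add_comm 1]

theorem Seg.bound {l : List (Token σ)} : ∀ {p : ℕ}, T.Seg w p l → p ≤ w.length + 1 →
    p + l.length ≤ w.length + 1 := by
  induction l with
  | nil => intro p _ hp; exact hp
  | cons t l ih =>
    intro p h hp
    have := h.1.bounds
    have := ih h.2 (by omega)
    rw [List.length_cons]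
    omega

theorem run_one {q q' : EvalState A} {p p' a a' b b' c c' : ℕ} (m x y z : Move)
    (h : EvalState.trans T q (readInput w p) ![decide (a = 0), decide (b = 0), decide (c = 0)] =
      EvalState.ins q' m x y z) (hp : m.input w.length p = p')
    (ha : x.work a = a' ∧ a' ≤ w.length + 1) (hb : y.work b = b' ∧ b' ≤ w.length + 1)
    (hc : z.work c = c' ∧ c' ≤ w.length + 1) :
    T.Run w (T.cfg q p a b c) (T.cfg q' p' a' b' c') := by
  have hz : (fun j => decide ((T.cfg q p a b c).ctr j = 0)) =
      ![decide (a = 0), decide (b = 0), decide (c = 0)] := by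
    funext j
    change Fin 3 at j
    fin_cases j <;> rfl
  refine .single ⟨?_, ?_⟩
  · have hi : (evalAutomaton T).instr w (T.cfg q p a b c) = some (q', m, ![x, y, z]) := by
      rw [CounterAutomaton.instr, hz]
      exact h
    refine Option.map_eq_some_iff.2 ⟨_, hi, ?_⟩
    simp only [cfg, ← hp, ← ha.1, ← hb.1, ← hc.1, CounterAutomaton.exec]
    congr 1
    funext j
    change Fin 3 at j
    fin_cases j <;> rfl
  · intro j
    change Fin 3 at j
    fin_cases j
    · exact ha.2
    · exact hb.2
    · exact hc.2

theorem Run.trans {c d e : (evalAutomaton T).Cfg} (h : T.Run w c d) (h' : T.Run w d e) :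
    T.Run w c e := ReflTransGen.trans h h'

theorem input_right {p : ℕ} (h : p ≤ w.length) : Move.right.input w.length p = p + 1 := by
  simp only [Move.input]
  omega

/-! #### Skipping irrelevant parts -/

def IsParen : Token σ → Prop
  | .lparen => True
  | .rparen => True
  | _ => False

/-- Tokens that are ignored in the search for quantifiers. -/
def IsNeutral : Token σ → Prop
  | .rparen => True
  | .comma => True
  | .bit _ => True
  | .rel _ => True
  | _ => False

theorem mem_encodeVar {x : ℕ} {t : Token σ} (h : t ∈ encodeVar σ x) :
    t = .comma ∨ ∃ b, t = .bit b := by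
  rcases List.mem_append.1 h with h | h
  · obtain ⟨b, -, rfl⟩ := List.mem_map.1 h
    exact .inr ⟨b, rfl⟩
  · exact .inl (List.mem_singleton.1 h)

theorem isNeutral_of_mem_encodeVar {x : ℕ} {t : Token σ} (h : t ∈ encodeVar σ x) :
    IsNeutral t := by
  rcases mem_encodeVar h with rfl | ⟨b, rfl⟩ <;> trivial

theorem not_isParen_of_mem_encodeVar {x : ℕ} {t : Token σ} (h : t ∈ encodeVar σ x) :
    ¬ IsParen t := by
  rcases mem_encodeVar h with rfl | ⟨b, rfl⟩ <;> exact id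

theorem run_skip_list {b : Bool} {a : ℕ} (ha : a ≤ w.length + 1) (l : List (Token σ)) :
    ∀ {p : ℕ}, T.Seg w p l → (∀ t ∈ l, ¬ IsParen t) →
    T.Run w (T.cfg (.skip b) p a 0 0) (T.cfg (.skip b) (p + l.length) a 0 0) := by
  induction l with
  | nil => exact fun _ _ => .refl
  | cons t l ih =>
    intro p h hl
    have hb := h.1.bounds
    obtain ⟨⟨g, hg, ht⟩, h⟩ := h
    have := ih h fun t ht => hl t (List.mem_cons_of_mem _ ht)
    rw [List.length_cons, Nat.add_comm _ 1, ← Nat.add_assoc]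
    refine Run.trans (run_one .right .stay .stay .stay ?_ (input_right hb.2) ⟨rfl, ha⟩
      ⟨rfl, Nat.zero_le _⟩ ⟨rfl, Nat.zero_le _⟩) this
    have := hl t (by simp)
    cases t <;> simp_all [EvalState.trans, IsParen]

/-- Parentheses are balanced in a formula, so each closing one inside it meets a positive counter
and cannot end the skipping. The value `a` is arbitrary because operands are traversed with a raised
counter. -/
theorem run_skip {b : Bool} (φ : Fml σ) : ∀ {p a : ℕ}, T.Seg w p φ.encode →
    a + φ.encode.length ≤ w.length + 1 →
    T.Run w (T.cfg (.skip b) p a 0 0) (T.cfg (.skip b) (p + φ.encode.length) a 0 0) := by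
  have binary : ∀ (φ ψ : Fml σ) (t : Token σ), ¬ IsParen t →
      (∀ {p a : ℕ}, T.Seg w p φ.encode → a + φ.encode.length ≤ w.length + 1 →
        T.Run w (T.cfg (.skip b) p a 0 0) (T.cfg (.skip b) (p + φ.encode.length) a 0 0)) →
      (∀ {p a : ℕ}, T.Seg w p ψ.encode → a + ψ.encode.length ≤ w.length + 1 →
        T.Run w (T.cfg (.skip b) p a 0 0) (T.cfg (.skip b) (p + ψ.encode.length) a 0 0)) →
      ∀ {p a : ℕ}, T.Seg w p (.lparen :: (φ.encode ++ t :: (ψ.encode ++ [.rparen]))) →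
      a + (Token.lparen :: (φ.encode ++ t :: (ψ.encode ++ [.rparen]))).length ≤ w.length + 1 →
      T.Run w (T.cfg (.skip b) p a 0 0) (T.cfg (.skip b)
        (p + (Token.lparen :: (φ.encode ++ t :: (ψ.encode ++ [.rparen]))).length) a 0 0) := by
    intro φ ψ t ht ihφ ihψ p a h ha
    simp only [Seg, seg_append] at h
    obtain ⟨h1, h2, h3, h4, h5, -⟩ := h
    have b1 := h1.bounds
    have b5 := h5.bounds
    simp only [List.length_cons, List.length_append, List.length_nil] at ha ⊢
    obtain ⟨g1, hg1, ht1⟩ := h1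
    obtain ⟨g5, hg5, ht5⟩ := h5
    refine Run.trans (run_one (q' := .skip b) (a' := a + 1) .right .right .stay .stay ?_
      (input_right b1.2) ⟨rfl, by omega⟩ ⟨rfl, Nat.zero_le _⟩ ⟨rfl, Nat.zero_le _⟩) ?_
    · simp [EvalState.trans, hg1, ht1]
    refine Run.trans (ihφ h2 (by omega)) ?_
    refine Run.trans (run_skip_list (by omega) [t] ⟨h3, trivial⟩ (by simpa using ht)) ?_
    refine Run.trans (ihψ h4 (by omega)) ?_
    refine run_one .right .left .stay .stay ?_ ?_ ⟨rfl, by omega⟩ ⟨rfl, Nat.zero_le _⟩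
      ⟨rfl, Nat.zero_le _⟩
    · simp only [List.length_singleton]
      simp [EvalState.trans, hg5, ht5]
    · rw [List.length_singleton, input_right b5.2]
      omega
  have quant : ∀ (x : ℕ) (φ : Fml σ) (t : Token σ), ¬ IsParen t →
      (∀ {p a : ℕ}, T.Seg w p φ.encode → a + φ.encode.length ≤ w.length + 1 →
        T.Run w (T.cfg (.skip b) p a 0 0) (T.cfg (.skip b) (p + φ.encode.length) a 0 0)) →
      ∀ {p a : ℕ}, T.Seg w p (t :: (encodeVar σ x ++ φ.encode)) →
      a + (t :: (encodeVar σ x ++ φ.encode)).length ≤ w.length + 1 →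
      T.Run w (T.cfg (.skip b) p a 0 0) (T.cfg (.skip b)
        (p + (t :: (encodeVar σ x ++ φ.encode)).length) a 0 0) := by
    intro x φ t ht ih p a h ha
    rw [← List.cons_append, seg_append] at h
    rw [← List.cons_append, List.length_append] at ha ⊢
    rw [← Nat.add_assoc]
    refine Run.trans (run_skip_list (by omega) _ h.1 fun u hu => ?_) (ih h.2 (by omega))
    rcases List.mem_cons.1 hu with rfl | hu
    · exact ht
    · exact not_isParen_of_mem_encodeVar hu
  induction φ with
  | atom R v =>
    intro p a h ha
    refine run_skip_list (by omega) _ h fun t ht => ?_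
    rcases List.mem_cons.1 ht with rfl | ht
    · exact id
    · obtain ⟨x, -, hx⟩ := List.mem_flatMap.1 ht
      exact not_isParen_of_mem_encodeVar hx
  | and φ ψ ihφ ihψ => exact fun h ha => binary φ ψ .and id ihφ ihψ h ha
  | or φ ψ ihφ ihψ => exact fun h ha => binary φ ψ .or id ihφ ihψ h ha
  | ex x φ ih => exact fun h ha => quant x φ .ex id ih h ha
  | all x φ ih => exact fun h ha => quant x φ .all id ih h ha

theorem run_look_list {c : AtomState A} {a : ℕ} (ha : a ≤ w.length + 1) (l : List (Token σ)) :
    ∀ {p k : ℕ}, T.Seg w (p + 1) l → (∀ t ∈ l, IsNeutral t) → k + l.length ≤ w.length + 1 →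
    T.Run w (T.cfg (.look c) (p + l.length) a k 0) (T.cfg (.look c) p a (k + l.length) 0) := by
  induction l with
  | nil => exact fun _ _ _ => .refl
  | cons t l ih =>
    intro p k h hl hk
    obtain ⟨⟨g, hg, ht⟩, h⟩ := h
    have := ih (k := k) h (fun t ht => hl t (List.mem_cons_of_mem _ ht)) (by simp at hk; omega)
    rw [List.length_cons] at hk ⊢
    rw [Nat.add_assoc p 1, Nat.add_comm 1] at this
    refine Run.trans this (run_one .left .stay .right .stay ?_ rfl ⟨rfl, ha⟩
      ⟨rfl, by omega⟩ ⟨rfl, by omega⟩)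
    have := hl t (by simp)
    cases t <;> simp_all [EvalState.trans, IsNeutral]

theorem run_look_op {c : AtomState A} {t : Token σ} (ht : t = .and ∨ t = .or) {p a k : ℕ}
    (h : T.TokAt w (p + 1) t) (ha : a ≤ w.length) (hk : k ≤ w.length) :
    T.Run w (T.cfg (.look c) (p + 1) a k 0) (T.cfg (.look c) p (a + 1) (k + 1) 0) := by
  obtain ⟨g, hg, htg⟩ := h
  refine run_one .left .right .right .stay ?_ rfl ⟨rfl, by omega⟩ ⟨rfl, by omega⟩ ⟨rfl, by omega⟩
  rcases ht with rfl | rfl <;> simp [EvalState.trans, hg, htg]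

/-- Truncated subtraction covers both uses: a positive `a` records a connective whose parenthesis is
found here, while `a = 0` means that the search comes from a left operand. -/
theorem run_look_lparen {c : AtomState A} {p a k : ℕ} (h : T.TokAt w (p + 1) .lparen)
    (ha : a ≤ w.length + 1) (hk : k ≤ w.length) :
    T.Run w (T.cfg (.look c) (p + 1) a k 0) (T.cfg (.look c) p (a - 1) (k + 1) 0) := by
  obtain ⟨g, hg, htg⟩ := h
  refine run_one .left .left .right .stay ?_ rfl ⟨rfl, by omega⟩ ⟨rfl, by omega⟩ ⟨rfl, by omega⟩
  simp [EvalState.trans, hg, htg]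

/-- Read from right to left, each connective precedes its opening parenthesis, so the counter never
falls below its initial positive value inside `φ`. Hence no quantifier of `φ` is taken for the
binding one. -/
theorem run_look_fml {c : AtomState A} (φ : Fml σ) : ∀ {p a k : ℕ}, T.Seg w (p + 1) φ.encode →
    a + 1 + φ.encode.length ≤ w.length + 1 → k + φ.encode.length ≤ w.length + 1 →
    T.Run w (T.cfg (.look c) (p + φ.encode.length) (a + 1) k 0)
      (T.cfg (.look c) p (a + 1) (k + φ.encode.length) 0) := by
  have binary : ∀ (φ ψ : Fml σ) (t : Token σ), (t = .and ∨ t = .or) →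
      (∀ {p a k : ℕ}, T.Seg w (p + 1) φ.encode →
        a + 1 + φ.encode.length ≤ w.length + 1 → k + φ.encode.length ≤ w.length + 1 →
        T.Run w (T.cfg (.look c) (p + φ.encode.length) (a + 1) k 0)
          (T.cfg (.look c) p (a + 1) (k + φ.encode.length) 0)) →
      (∀ {p a k : ℕ}, T.Seg w (p + 1) ψ.encode →
        a + 1 + ψ.encode.length ≤ w.length + 1 → k + ψ.encode.length ≤ w.length + 1 →
        T.Run w (T.cfg (.look c) (p + ψ.encode.length) (a + 1) k 0)
          (T.cfg (.look c) p (a + 1) (k + ψ.encode.length) 0)) →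
      ∀ {p a k n : ℕ}, T.Seg w (p + 1) (.lparen :: (φ.encode ++ t :: (ψ.encode ++ [.rparen]))) →
      n = (Token.lparen :: (φ.encode ++ t :: (ψ.encode ++ [.rparen]))).length →
      a + 1 + n ≤ w.length + 1 → k + n ≤ w.length + 1 →
      T.Run w (T.cfg (.look c) (p + n) (a + 1) k 0) (T.cfg (.look c) p (a + 1) (k + n) 0) := by
    intro φ ψ t ht ihφ ihψ p a k n h hn ha hk
    simp only [Seg, seg_append] at h
    obtain ⟨h1, h2, h3, h4, h5, -⟩ := h
    simp only [List.length_cons, List.length_append, List.length_nil] at hn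
    have r5 := run_look_list (T := T) (w := w) (c := c) (a := a + 1) (by omega) [.rparen]
      (p := p + 1 + φ.encode.length + 1 + ψ.encode.length) (k := k)
      (by refine ⟨?_, trivial⟩; convert h5 using 1; omega) (by simp [IsNeutral]) (by simp; omega)
    have r4 := ihψ (p := p + 1 + φ.encode.length + 1) (a := a) (k := k + 1)
      (by convert h4 using 1; omega) (by omega) (by omega)
    have r3 := run_look_op (c := c) (a := a + 1) (k := k + 1 + ψ.encode.length) ht
      (p := p + 1 + φ.encode.length) (by convert h3 using 1; omega) (by omega) (by omega)
    have r2 := ihφ (p := p + 1) (a := a + 1) (k := k + 1 + ψ.encode.length + 1) h2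
      (by omega) (by omega)
    have r1 := run_look_lparen (c := c) (a := a + 1 + 1)
      (k := k + 1 + ψ.encode.length + 1 + φ.encode.length) h1 (by omega) (by omega)
    have := (((r5.trans r4).trans r3).trans r2).trans r1
    rw [List.length_singleton] at this
    convert this using 2 <;> omega
  have quant : ∀ (x : ℕ) (φ : Fml σ) (t : Token σ), (t = .ex ∨ t = .all) →
      (∀ {p a k : ℕ}, T.Seg w (p + 1) φ.encode →
        a + 1 + φ.encode.length ≤ w.length + 1 → k + φ.encode.length ≤ w.length + 1 →
        T.Run w (T.cfg (.look c) (p + φ.encode.length) (a + 1) k 0)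
          (T.cfg (.look c) p (a + 1) (k + φ.encode.length) 0)) →
      ∀ {p a k n : ℕ}, T.Seg w (p + 1) (t :: (encodeVar σ x ++ φ.encode)) →
      n = (t :: (encodeVar σ x ++ φ.encode)).length →
      a + 1 + n ≤ w.length + 1 → k + n ≤ w.length + 1 →
      T.Run w (T.cfg (.look c) (p + n) (a + 1) k 0) (T.cfg (.look c) p (a + 1) (k + n) 0) := by
    intro x φ t ht ih p a k n h hn ha hk
    simp only [Seg, seg_append] at h
    obtain ⟨⟨g, hg, htg⟩, h2, h3⟩ := h
    simp only [List.length_cons, List.length_append] at hn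
    have r3 := ih (p := p + 1 + (encodeVar σ x).length) (a := a) (k := k)
      (by convert h3 using 1; omega) (by omega) (by omega)
    have r2 := run_look_list (T := T) (w := w) (c := c) (a := a + 1) (by omega) (encodeVar σ x)
      (p := p + 1) (k := k + φ.encode.length) h2 (fun t ht => isNeutral_of_mem_encodeVar ht)
      (by omega)
    have r1 : T.Run w (T.cfg (.look c) (p + 1) (a + 1)
        (k + φ.encode.length + (encodeVar σ x).length) 0) (T.cfg (.look c) p (a + 1)
        (k + φ.encode.length + (encodeVar σ x).length + 1) 0) := by
      refine run_one .left .stay .right .stay ?_ rfl ⟨rfl, by omega⟩ ⟨rfl, by omega⟩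
        ⟨rfl, by omega⟩
      rcases ht with rfl | rfl <;> simp [EvalState.trans, hg, htg]
    have := (r3.trans r2).trans r1
    convert this using 2 <;> omega
  induction φ with
  | atom R v =>
    intro p a k h ha hk
    refine run_look_list (by omega) _ h (fun t ht => ?_) hk
    rcases List.mem_cons.1 ht with rfl | ht
    · trivial
    · obtain ⟨x, -, hx⟩ := List.mem_flatMap.1 ht
      exact isNeutral_of_mem_encodeVar hx
  | and φ ψ ihφ ihψ => exact fun h ha hk => binary φ ψ .and (.inl rfl) ihφ ihψ h rfl ha hk
  | or φ ψ ihφ ihψ => exact fun h ha hk => binary φ ψ .or (.inr rfl) ihφ ihψ h rfl ha hk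
  | ex x φ ih => exact fun h ha hk => quant x φ .ex (.inl rfl) ih h rfl ha hk
  | all x φ ih => exact fun h ha hk => quant x φ .all (.inr rfl) ih h rfl ha hk

end Reading

namespace Reading

variable {σ : Signature} {A : RelStr σ} {Γ : Type} {T : Reading A Γ} {w : List Γ}

/-! #### Comparing variables -/

theorem run_fwd {c : AtomState A} {d : A.carrier} {t : Option Bool} (b : ℕ) : ∀ {p e : ℕ},
    p + b ≤ w.length + 1 → e + b ≤ w.length + 1 →
    T.Run w (T.cfg (.fwd c d t) p 0 b e) (T.cfg (.fwd c d t) (p + b) 0 0 (e + b)) := by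
  induction b with
  | zero => exact fun _ _ => .refl
  | succ b ih =>
    intro p e hp he
    have := ih (p := p + 1) (e := e + 1) (by omega) (by omega)
    rw [Nat.add_assoc p, Nat.add_assoc e, Nat.add_comm 1] at this
    refine Run.trans (run_one .right .stay .left .right ?_ (input_right (by omega))
      ⟨rfl, Nat.zero_le _⟩ ⟨rfl, by simp only [Move.work]; omega⟩
      ⟨rfl, by simp only [Move.work]; omega⟩) this
    simp [EvalState.trans]

theorem run_bwd {c : AtomState A} {o : Option A.carrier} (e : ℕ) : ∀ {p b : ℕ},
    e + b ≤ w.length + 1 →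
    T.Run w (T.cfg (.bwd c o) (p + e) 0 b e) (T.cfg (.bwd c o) p 0 (b + e) 0) := by
  induction e with
  | zero => exact fun _ => .refl
  | succ e ih =>
    intro p b he
    have := ih (p := p) (b := b + 1) (by omega)
    rw [Nat.add_assoc b, Nat.add_comm 1] at this
    refine Run.trans (run_one .left .stay .right .left ?_ rfl
      ⟨rfl, Nat.zero_le _⟩ ⟨rfl, by simp only [Move.work]; omega⟩
      ⟨rfl, by simp only [Move.work]; omega⟩) this
    simp [EvalState.trans]

theorem run_clear {c : AtomState A} {d : A.carrier} {p : ℕ} (e : ℕ) (he : e ≤ w.length + 1) :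
    T.Run w (T.cfg (.clear c d) p 0 0 e) (T.cfg (.clear c d) p 0 0 0) := by
  induction e with
  | zero => exact .refl
  | succ e ih =>
    refine Run.trans (run_one .stay .stay .stay .left ?_ rfl
      ⟨rfl, Nat.zero_le _⟩ ⟨rfl, Nat.zero_le _⟩
      ⟨rfl, by simp only [Move.work]; omega⟩) (ih (by omega))
    simp [EvalState.trans]

theorem run_toQ {c : AtomState A} {k : ℕ} (hk : k ≤ w.length + 1) (l : List (Token σ)) :
    ∀ {p j : ℕ}, T.Seg w (p + 1) l → (∀ t ∈ l, t = .comma ∨ ∃ b, t = .bit b) → j ≤ l.length →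
    T.Run w (T.cfg (.toQ c) (p + j) 0 k 0) (T.cfg (.toQ c) p 0 k 0) := by
  induction l with
  | nil =>
    intro p j _ _ hj
    obtain rfl := Nat.le_zero.1 hj
    exact .refl
  | cons t l ih =>
    intro p j h hl hj
    cases j with
    | zero => exact .refl
    | succ j =>
      obtain ⟨⟨g, hg, ht⟩, h⟩ := h
      have := ih (j := j) h (fun t ht => hl t (List.mem_cons_of_mem _ ht)) (by simpa using hj)
      rw [Nat.add_assoc p, Nat.add_comm 1] at this
      refine Run.trans this (run_one .left .stay .stay .stay ?_ rfl
        ⟨rfl, Nat.zero_le _⟩ ⟨rfl, hk⟩ ⟨rfl, Nat.zero_le _⟩)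
      rcases hl t (by simp) with rfl | ⟨b, rfl⟩ <;> simp [EvalState.trans, hg, ht]

/-- The letter of a variable as the automaton remembers it: a bit, or `none` for the comma. -/
def letter : Option Bool → Token σ
  | some b => .bit b
  | none => .comma

/-- Comparison of a single letter. -/
theorem run_cmp_letter {c : AtomState A} {d : A.carrier} {t u : Option Bool} {p k : ℕ}
    (ht : T.TokAt w p (letter t)) (hu : T.TokAt w (p + k) (letter u)) :
    T.Run w (T.cfg (.cmp c d) p 0 k 0)
      (if t = u then if t = none then T.cfg (.clear c d) (p + k) 0 0 k
        else T.cfg (.cmp c d) (p + 1) 0 k 0 else T.cfg (.toQ c) p 0 k 0) := by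
  have hp := ht.bounds
  have hk := hu.bounds
  obtain ⟨g, hg, htg⟩ := ht
  obtain ⟨g', hg', htg'⟩ := hu
  have h1 : T.Run w (T.cfg (.cmp c d) p 0 k 0) (T.cfg (.fwd c d t) p 0 k 0) := by
    refine run_one .stay .stay .stay .stay ?_ rfl ⟨rfl, Nat.zero_le _⟩ ⟨rfl, by omega⟩
      ⟨rfl, Nat.zero_le _⟩
    cases t <;> simp [EvalState.trans, hg, htg, letter]
  have h2 := run_fwd (T := T) (w := w) (c := c) (d := d) (t := t) k (p := p) (e := 0) (by omega)
    (by omega)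
  rw [Nat.zero_add] at h2
  have h4 : ∀ o : Option A.carrier, T.Run w (T.cfg (.bwd c o) (p + k) 0 0 k)
      (T.cfg (.bwd c o) p 0 k 0) := fun o => by
    have := run_bwd (T := T) (w := w) (c := c) (o := o) k (p := p) (b := 0) (by omega)
    rwa [Nat.zero_add] at this
  refine (h1.trans h2).trans ?_
  by_cases htu : t = u
  · subst htu
    rw [if_pos rfl]
    cases t with
    | none =>
      rw [if_pos rfl]
      refine run_one .stay .stay .stay .stay ?_ rfl ⟨rfl, Nat.zero_le _⟩ ⟨rfl, Nat.zero_le _⟩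
        ⟨rfl, by omega⟩
      simp [EvalState.trans, hg', htg', letter]
    | some b =>
      rw [if_neg (by simp)]
      refine Run.trans (run_one (q' := .bwd c (some d)) .stay .stay .stay .stay ?_ rfl
        ⟨rfl, Nat.zero_le _⟩ ⟨rfl, Nat.zero_le _⟩
        ⟨rfl, by simp only [Move.work]; omega⟩) ((h4 _).trans ?_)
      · simp [EvalState.trans, hg', htg', letter]
      · refine run_one .right .stay .stay .stay ?_ (input_right hp.2) ⟨rfl, Nat.zero_le _⟩
          ⟨rfl, by omega⟩ ⟨rfl, Nat.zero_le _⟩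
        simp [EvalState.trans]
  · rw [if_neg htu]
    refine Run.trans (run_one (q' := .bwd c none) .stay .stay .stay .stay ?_ rfl
      ⟨rfl, Nat.zero_le _⟩ ⟨rfl, Nat.zero_le _⟩
      ⟨rfl, by simp only [Move.work]; omega⟩) ((h4 _).trans ?_)
    · have hut : u ≠ t := fun e => htu e.symm
      cases t <;> cases u <;> simp_all [EvalState.trans, letter]
    · refine run_one .stay .stay .stay .stay ?_ rfl ⟨rfl, Nat.zero_le _⟩
        ⟨rfl, by omega⟩ ⟨rfl, Nat.zero_le _⟩
      simp [EvalState.trans]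

theorem run_cmp_eq {c : AtomState A} {d : A.carrier} {k : ℕ} (l : List Bool) : ∀ {p : ℕ},
    T.Seg w p (l.map .bit ++ [.comma]) → T.Seg w (p + k) (l.map .bit ++ [.comma]) →
    T.Run w (T.cfg (.cmp c d) p 0 k 0) (T.cfg (.clear c d) (p + k + l.length) 0 0 k) := by
  induction l with
  | nil =>
    intro p h h'
    exact run_cmp_letter (t := none) (u := none) h.1 h'.1
  | cons b l ih =>
    intro p h h'
    have := ih h.2 (by rw [Nat.add_right_comm]; exact h'.2)
    rw [List.length_cons, Nat.add_comm _ 1, ← Nat.add_assoc, Nat.add_right_comm p k]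
    refine Run.trans ?_ this
    have := run_cmp_letter (c := c) (d := d) (t := some b) (u := some b) h.1 h'.1
    simpa using this

/-- Because of the terminating commas, different bit words disagree at a letter of both names; `j`
is the offset of the first disagreement, where the head is left with the distance intact. -/
theorem run_cmp_ne {c : AtomState A} {d : A.carrier} {k : ℕ} (l : List Bool) :
    ∀ (m : List Bool) {p : ℕ}, l ≠ m → T.Seg w p (l.map .bit ++ [.comma]) →
    T.Seg w (p + k) (m.map .bit ++ [.comma]) →
    ∃ j ≤ l.length, T.Run w (T.cfg (.cmp c d) p 0 k 0) (T.cfg (.toQ c) (p + j) 0 k 0) := by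
  induction l with
  | nil =>
    intro m p hm h h'
    obtain ⟨b, m, rfl⟩ := List.exists_cons_of_ne_nil hm.symm
    exact ⟨0, le_rfl, run_cmp_letter (t := none) (u := some b) h.1 h'.1⟩
  | cons b l ih =>
    intro m p hm h h'
    cases m with
    | nil => exact ⟨0, Nat.zero_le _, run_cmp_letter (t := some b) (u := none) h.1 h'.1⟩
    | cons b' m =>
      have h0 := run_cmp_letter (c := c) (d := d) (t := some b) (u := some b') h.1 h'.1
      by_cases hb : b = b'
      · subst hb
        obtain ⟨j, hj, hr⟩ := ih m (fun e => hm (by rw [e])) h.2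
          (by rw [Nat.add_right_comm]; exact h'.2)
        refine ⟨j + 1, by simpa using hj, Run.trans ?_
          (by rwa [Nat.add_assoc, Nat.add_comm 1] at hr)⟩
        simpa using h0
      · refine ⟨0, Nat.zero_le _, ?_⟩
        simpa [hb] using h0

/-! #### Finding the value of a variable -/

variable (T w) in
/-- The search for the variable `x`, starting at position `p`, finds the value `d`. -/
def Binds (p x : ℕ) (d : A.carrier) : Prop :=
  ∀ (k : ℕ) (c : AtomState A), T.Seg w (p + k + 1) (encodeVar σ x) →
    T.Run w (T.cfg (.look c) p 0 k 0) (T.cfg (.clear c d) (p + k + (encodeVar σ x).length) 0 0 0)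

theorem Seg.encodeVar_bound {p x : ℕ} (h : T.Seg w p (encodeVar σ x)) :
    1 ≤ p ∧ p ≤ w.length := by
  have : (encodeVar σ x) ≠ [] := by simp [encodeVar]
  obtain ⟨t, l, hl⟩ := List.exists_cons_of_ne_nil this
  rw [hl] at h
  exact h.1.bounds

/-- `Binds` quantifies over the distance `k`, so a search that merely walks over tokens reduces to
one starting further left with larger `k`. -/
theorem Binds.neutral {p x : ℕ} {d : A.carrier} (h : T.Binds w p x d) {l : List (Token σ)}
    (hl : T.Seg w (p + 1) l) (hn : ∀ t ∈ l, IsNeutral t) : T.Binds w (p + l.length) x d := by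
  intro k c hs
  have := hs.encodeVar_bound
  have h1 := run_look_list (c := c) (a := 0) (Nat.zero_le _) l (k := k) hl hn (by omega)
  have h2 := h (k + l.length) c (by convert hs using 1; omega)
  have := h1.trans h2
  convert this using 2
  omega

theorem Binds.lparen {p x : ℕ} {d : A.carrier} (h : T.Binds w p x d)
    (hl : T.TokAt w (p + 1) .lparen) : T.Binds w (p + 1) x d := by
  intro k c hs
  have := hs.encodeVar_bound
  have h1 := run_look_lparen (c := c) (a := 0) (k := k) hl (by omega) (by omega)
  have h2 := h (k + 1) c (by convert hs using 1; omega)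
  have := h1.trans h2
  convert this using 2
  omega

/-- From a right operand the search raises the counter at the connective, crosses the left operand,
and restores zero at the parenthesis: it has left the compound formula without being caught by a
quantifier in `φ`. -/
theorem Binds.right {p x : ℕ} {d : A.carrier} (h : T.Binds w p x d)
    (hl : T.TokAt w (p + 1) .lparen) {φ : Fml σ} (hφ : T.Seg w (p + 1 + 1) φ.encode)
    {t : Token σ} (ht : t = .and ∨ t = .or) (hop : T.TokAt w (p + 1 + φ.encode.length + 1) t) :
    T.Binds w (p + 1 + φ.encode.length + 1) x d := by
  intro k c hs
  have := hs.encodeVar_bound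
  have h1 := run_look_op (c := c) (a := 0) (k := k) ht hop (by omega) (by omega)
  have h2 := run_look_fml (c := c) φ (a := 0) (k := k + 1) hφ (by omega) (by omega)
  have h3 := run_look_lparen (c := c) (a := 0 + 1) (k := k + 1 + φ.encode.length) hl (by omega)
    (by omega)
  have h4 := h (k + 1 + φ.encode.length + 1) c (by convert hs using 1; omega)
  have := ((h1.trans h2).trans h3).trans h4
  convert this using 2
  omega

/-- A quantifier that assigns `e` to its variable is written at position `p`. -/
def QuantAt (T : Reading A Γ) (w : List Γ) (p : ℕ) (e : A.carrier) : Prop :=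
  ∃ g, readInput w p = .sym g ∧
    (T.tok g = .ex ∧ T.exVal g = e ∨ T.tok g = .all ∧ T.allVal g = e)

theorem QuantAt.run_cmp {p y k : ℕ} {e : A.carrier} (hq : QuantAt T w (p + 1) e)
    (hy : T.Seg w (p + 1 + 1) (encodeVar σ y)) (hk : k + (encodeVar σ y).length ≤ w.length + 1)
    (c : AtomState A) :
    T.Run w (T.cfg (.look c) (p + 1 + (encodeVar σ y).length) 0 k 0)
      (T.cfg (.cmp c e) (p + 1 + 1) 0 (k + (encodeVar σ y).length) 0) := by
  obtain ⟨g, hg, hq⟩ := hq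
  refine Run.trans (run_look_list (Nat.zero_le _) (encodeVar σ y) hy
    (fun t ht => isNeutral_of_mem_encodeVar ht) hk) ?_
  refine run_one .right .stay .stay .stay ?_ (input_right (sym_pos_bounds hg).2)
    ⟨rfl, Nat.zero_le _⟩ ⟨rfl, hk⟩ ⟨rfl, Nat.zero_le _⟩
  rcases hq with ⟨ht, rfl⟩ | ⟨ht, rfl⟩ <;> simp [EvalState.trans, hg, ht]

theorem QuantAt.binds_self {p y : ℕ} {e : A.carrier} (hq : QuantAt T w (p + 1) e)
    (hy : T.Seg w (p + 1 + 1) (encodeVar σ y)) :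
    T.Binds w (p + 1 + (encodeVar σ y).length) y e := by
  intro k c hs
  have := hs.encodeVar_bound
  have h1 := hq.run_cmp (k := k) hy (by omega) c
  have h2 := run_cmp_eq (c := c) (d := e) (k := k + (encodeVar σ y).length) y.bits hy
    (by rw [← encodeVar]; convert hs using 1; omega)
  have h3 := h1.trans (h2.trans (run_clear _ (by omega)))
  convert h3 using 2
  simp [encodeVar]
  omega

theorem QuantAt.binds_of_ne {p y x : ℕ} {e d : A.carrier} (hq : QuantAt T w (p + 1) e)
    (hy : T.Seg w (p + 1 + 1) (encodeVar σ y)) (hxy : x ≠ y) (h : T.Binds w p x d) :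
    T.Binds w (p + 1 + (encodeVar σ y).length) x d := by
  intro k c hs
  have := hs.encodeVar_bound
  have h1 := hq.run_cmp (k := k) hy (by omega) c
  -- Unique readability of encoded variables yields injectivity of the binary expansion.
  have hbits : y.bits ≠ x.bits := by
    intro e
    have : encodeVar σ x ++ [] = encodeVar σ y ++ [] := by rw [encodeVar, encodeVar, e]
    exact hxy (encodeVar_cancel this).1
  obtain ⟨j, hj, h2⟩ := run_cmp_ne (c := c) (d := e) (k := k + (encodeVar σ y).length) y.bits
    x.bits hbits hy (by rw [← encodeVar]; convert hs using 1; omega)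
  have hjl : j + 1 ≤ (encodeVar σ y).length := by simpa [encodeVar] using hj
  have h3 := run_toQ (c := c) (k := k + (encodeVar σ y).length) (by omega) (encodeVar σ y)
    (j := j + 1) hy (fun t ht => mem_encodeVar ht) hjl
  rw [Nat.add_comm j, ← Nat.add_assoc] at h3
  have h4 : T.Run w (T.cfg (.toQ c) (p + 1) 0 (k + (encodeVar σ y).length) 0)
      (T.cfg (.look c) p 0 (k + (encodeVar σ y).length + 1) 0) := by
    obtain ⟨g, hg, hq⟩ := hq
    refine run_one .left .stay .right .stay ?_ rfl
      ⟨rfl, Nat.zero_le _⟩ ⟨rfl, by omega⟩ ⟨rfl, Nat.zero_le _⟩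
    rcases hq with ⟨ht, -⟩ | ⟨ht, -⟩ <;> simp [EvalState.trans, hg, ht]
  have h5 := h (k + (encodeVar σ y).length + 1) c (by convert hs using 1; omega)
  have := (((h1.trans h2).trans h3).trans h4).trans h5
  convert this using 2
  omega

/-- The innermost quantifier is met first by a search to the left, which is exactly the shadowing
expressed by `Function.update`. This carries the invariant of `run_eval` under quantifiers. -/
theorem QuantAt.binds_update {p y : ℕ} {e : A.carrier} (hq : QuantAt T w (p + 1) e)
    (hy : T.Seg w (p + 1 + 1) (encodeVar σ y)) {s : ℕ → A.carrier} {V : Set ℕ}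
    (h : ∀ x ∈ V \ {y}, T.Binds w p x (s x)) :
    ∀ x ∈ V, T.Binds w (p + 1 + (encodeVar σ y).length) x (Function.update s y e x) := by
  intro x hx
  by_cases hxy : x = y
  · subst hxy
    rw [Function.update_self]
    exact hq.binds_self hy
  · rw [Function.update_of_ne hxy]
    exact hq.binds_of_ne hy hxy (h x ⟨hx, hxy⟩)

/-! #### Evaluation -/

-- Arguments are looked up one by one, with `n` more to follow argument `i`. The search for each
-- crosses the earlier arguments and the relation symbol, all neutral, so the bindings at the start
-- of the atom apply.
open Classical in
theorem run_look_atom {p : ℕ} (R : σ.Sym) (v : Fin (σ.arity R) → ℕ) (s : ℕ → A.carrier)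
    (h : T.Seg w (p + 1) (Fml.atom R v).encode) (hv : ∀ i, T.Binds w p (v i) (s (v i)))
    (n : ℕ) : ∀ (i : Fin (σ.arity R)) (u : Fin (σ.arity R) → A.carrier), i + n + 1 = σ.arity R →
    (∀ j < i, u j = s (v j)) →
    T.Run w (T.cfg (.look ⟨R, i, u⟩)
        (p + 1 + (((List.ofFn v).take i).flatMap (encodeVar σ)).length) 0 0 0)
      (T.cfg (.ret (decide ((fun i => s (v i)) ∈ A.rel R)))
        (p + 1 + (Fml.atom R v).encode.length) 0 0 0) := by
  have hfl : ∀ i : Fin (σ.arity R), ((List.ofFn v).take (i + 1)).flatMap (encodeVar σ) =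
      ((List.ofFn v).take i).flatMap (encodeVar σ) ++ encodeVar σ (v i) := by
    intro i
    rw [List.take_add_one]
    simp
  have hseg : ∀ i : Fin (σ.arity R), T.Seg w (p + 1)
      (.rel R :: ((List.ofFn v).take i).flatMap (encodeVar σ)) ∧ T.Seg w
      (p + 1 + (((List.ofFn v).take i).flatMap (encodeVar σ)).length + 1)
      (encodeVar σ (v i)) := by
    intro i
    rw [Fml.encode, ← List.take_append_drop (i + 1) (List.ofFn v), List.flatMap_append, hfl,
      ← List.cons_append, seg_append, ← List.cons_append, seg_append] at h
    refine ⟨h.1.1, ?_⟩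
    convert h.1.2 using 1
    rw [List.length_cons, Nat.add_assoc _ _ 1]
  have harg : ∀ (i : Fin (σ.arity R)) (u : Fin (σ.arity R) → A.carrier),
      T.Run w (T.cfg (.look ⟨R, i, u⟩)
        (p + 1 + (((List.ofFn v).take i).flatMap (encodeVar σ)).length) 0 0 0)
      (T.cfg (.clear ⟨R, i, u⟩ (s (v i)))
        (p + 1 + (((List.ofFn v).take (i + 1)).flatMap (encodeVar σ)).length) 0 0 0) := by
    intro i u
    have hb := (hv i).neutral (hseg i).1 fun t ht => by
      rcases List.mem_cons.1 ht with rfl | ht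
      · trivial
      · obtain ⟨x, -, hx⟩ := List.mem_flatMap.1 ht
        exact isNeutral_of_mem_encodeVar hx
    rw [List.length_cons, Nat.add_comm _ 1, ← Nat.add_assoc] at hb
    have := hb 0 ⟨R, i, u⟩ (hseg i).2
    rw [hfl, List.length_append, ← Nat.add_assoc]
    exact this
  induction n with
  | zero =>
    intro i u hi hu
    refine (harg i u).trans (run_one .right .stay .stay .stay ?_ ?_ ⟨rfl, Nat.zero_le _⟩
      ⟨rfl, Nat.zero_le _⟩ ⟨rfl, Nat.zero_le _⟩)
    · have hs : Function.update u i (s (v i)) = fun i => s (v i) := by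
        funext j
        rcases lt_trichotomy j i with hj | rfl | hj
        · rw [Function.update_of_ne hj.ne, hu j hj]
        · rw [Function.update_self]
        · have := j.2
          have : (i : ℕ) < j := hj
          omega
      have hlt : ¬ ((i : ℕ) + 1 < σ.arity R) := by omega
      simp only [EvalState.trans, EvalState.next, hs]
      simp [hlt]
    · have htake : (List.ofFn v).take (i + 1) = List.ofFn v :=
        List.take_of_length_le (by rw [List.length_ofFn]; omega)
      rw [htake, Fml.encode, List.length_cons]
      have := h.bound (by have := h.1.bounds; omega)
      rw [Fml.encode, List.length_cons] at this
      rw [input_right (by omega)]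
      omega
  | succ n ih =>
    intro i u hi hu
    have hlt : (i : ℕ) + 1 < σ.arity R := by omega
    refine (harg i u).trans (Run.trans (run_one .stay .stay .stay .stay ?_ rfl ⟨rfl, Nat.zero_le _⟩
      ⟨rfl, Nat.zero_le _⟩ ⟨rfl, Nat.zero_le _⟩)
      (ih ⟨i + 1, hlt⟩ (Function.update u i (s (v i))) (by simp only; omega) fun j hj => ?_))
    · simp [EvalState.trans, EvalState.next, hlt]
    · have hj' : (j : ℕ) < i + 1 := hj
      rcases lt_or_eq_of_le (Nat.lt_succ_iff.1 hj') with hj | hj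
      · have hj : j < i := hj
        rw [Function.update_of_ne hj.ne, hu j hj]
      · obtain rfl : j = i := Fin.ext hj
        rw [Function.update_self]

theorem run_qvar {x p : ℕ} (h : T.Seg w p (encodeVar σ x)) :
    T.Run w (T.cfg .qvar p 0 0 0) (T.cfg .eval (p + (encodeVar σ x).length) 0 0 0) := by
  have key : ∀ (l : List Bool) {p : ℕ}, T.Seg w p (l.map .bit ++ [.comma]) →
      T.Run w (T.cfg .qvar p 0 0 0) (T.cfg .eval (p + l.length + 1) 0 0 0) := by
    intro l
    induction l with
    | nil =>
      intro p h
      have hb := h.1.bounds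
      obtain ⟨⟨g, hg, ht⟩, -⟩ := h
      refine run_one .right .stay .stay .stay ?_ (input_right hb.2) ⟨rfl, Nat.zero_le _⟩
        ⟨rfl, Nat.zero_le _⟩ ⟨rfl, Nat.zero_le _⟩
      simp [EvalState.trans, hg, ht]
    | cons b l ih =>
      intro p h
      have hb := h.1.bounds
      obtain ⟨⟨g, hg, ht⟩, h⟩ := h
      have := ih h
      rw [List.length_cons, Nat.add_comm l.length 1, ← Nat.add_assoc]
      refine Run.trans (run_one .right .stay .stay .stay ?_ (input_right hb.2)
        ⟨rfl, Nat.zero_le _⟩ ⟨rfl, Nat.zero_le _⟩ ⟨rfl, Nat.zero_le _⟩) this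
      simp [EvalState.trans, hg, ht]
  have := key x.bits h
  simpa [encodeVar, Nat.add_assoc] using this

/-- The value read at position `p`. -/
noncomputable def annot (w : List Γ) (f : Γ → A.carrier) (p : ℕ) : A.carrier :=
  match readInput w p with
  | .sym g => f g
  | _ => Classical.arbitrary A.carrier

open Classical in
/-- The automaton computes the truth value of a formula. -/
theorem run_eval (φ : Fml σ) : ∀ {p : ℕ} {s : ℕ → A.carrier}, T.Seg w (p + 1) φ.encode →
    (∀ x ∈ φ.freeVars, T.Binds w p x (s x)) →
    T.Run w (T.cfg .eval (p + 1) 0 0 0) (T.cfg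
      (.ret (decide (φ.EvalAt A (annot w T.exVal) (annot w T.allVal) s (p + 1))))
      (p + 1 + φ.encode.length) 0 0 0) := by
  have step : ∀ {q q' : EvalState A} {p : ℕ}, p ≤ w.length →
      (EvalState.trans T q (readInput w p) ![true, true, true] =
        EvalState.ins q' .right .stay .stay .stay) →
      T.Run w (T.cfg q p 0 0 0) (T.cfg q' (p + 1) 0 0 0) := fun hp h =>
    run_one .right .stay .stay .stay h (input_right hp) ⟨rfl, Nat.zero_le _⟩
      ⟨rfl, Nat.zero_le _⟩ ⟨rfl, Nat.zero_le _⟩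
  -- a binary connective `t`, for which the left value `z` decides
  have binary : ∀ (φ ψ : Fml σ) (t : Token σ) (z : Bool),
      (t = .and ∧ z = false ∨ t = .or ∧ z = true) → ∀ (p : ℕ) (b₁ b₂ : Bool),
      T.Seg w (p + 1) (.lparen :: (φ.encode ++ t :: (ψ.encode ++ [.rparen]))) →
      T.Run w (T.cfg .eval (p + 1 + 1) 0 0 0)
        (T.cfg (.ret b₁) (p + 1 + 1 + φ.encode.length) 0 0 0) →
      T.Run w (T.cfg .eval (p + 1 + φ.encode.length + 1 + 1) 0 0 0)
        (T.cfg (.ret b₂) (p + 1 + φ.encode.length + 1 + 1 + ψ.encode.length) 0 0 0) →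
      T.Run w (T.cfg .eval (p + 1) 0 0 0) (T.cfg (.ret (if b₁ = z then z else b₂))
        (p + 1 + (Token.lparen :: (φ.encode ++ t :: (ψ.encode ++ [.rparen]))).length) 0 0 0) := by
    intro φ ψ t z htz p b₁ b₂ h hφ hψ
    simp only [Seg, seg_append] at h
    obtain ⟨h1, h2, h3, h4, h5, -⟩ := h
    have hb1 := h1.bounds
    have hb3 := h3.bounds
    have hb5 := h5.bounds
    obtain ⟨g1, hg1, ht1⟩ := h1
    obtain ⟨g3, hg3, ht3⟩ := h3
    obtain ⟨g5, hg5, ht5⟩ := h5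
    have r1 : T.Run w (T.cfg .eval (p + 1) 0 0 0) (T.cfg .eval (p + 1 + 1) 0 0 0) :=
      step hb1.2 (by simp [EvalState.trans, hg1, ht1])
    have hlen : p + 1 + (Token.lparen :: (φ.encode ++ t :: (ψ.encode ++ [.rparen]))).length =
        p + 1 + 1 + φ.encode.length + 1 + ψ.encode.length + 1 := by
      simp only [List.length_cons, List.length_append, List.length_nil]
      omega
    rw [hlen]
    refine (r1.trans hφ).trans ?_
    by_cases hbz : b₁ = z
    · subst hbz
      rw [if_pos rfl]
      have r2 : T.Run w (T.cfg (.ret b₁) (p + 1 + 1 + φ.encode.length) 0 0 0)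
          (T.cfg (.skip b₁) (p + 1 + 1 + φ.encode.length + 1) 0 0 0) := by
        refine step hb3.2 ?_
        rcases htz with ⟨rfl, rfl⟩ | ⟨rfl, rfl⟩ <;> simp [EvalState.trans, hg3, ht3]
      refine (r2.trans (run_skip ψ h4 (by omega))).trans ?_
      -- The balanced operand leaves the counter at zero, so this parenthesis is recognized as the
      -- end of the skipped part.
      refine run_one .right .left .stay .stay ?_ (input_right hb5.2) ⟨rfl, Nat.zero_le _⟩
        ⟨rfl, Nat.zero_le _⟩ ⟨rfl, Nat.zero_le _⟩
      simp [EvalState.trans, hg5, ht5]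
    · rw [if_neg hbz]
      have r2 : T.Run w (T.cfg (.ret b₁) (p + 1 + 1 + φ.encode.length) 0 0 0)
          (T.cfg .eval (p + 1 + 1 + φ.encode.length + 1) 0 0 0) := by
        refine step hb3.2 ?_
        rcases htz with ⟨rfl, rfl⟩ | ⟨rfl, rfl⟩ <;> simp_all [EvalState.trans]
      have hpos : p + 1 + φ.encode.length + 1 + 1 = p + 1 + 1 + φ.encode.length + 1 := by omega
      rw [hpos] at hψ
      refine (r2.trans hψ).trans (step hb5.2 ?_)
      simp [EvalState.trans, hg5, ht5]
  induction φ with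
  | atom R v =>
    intro p s h hv
    obtain ⟨g, hg, ht⟩ := h.1
    refine Run.trans (run_one .stay .stay .stay .stay ?_ rfl ⟨rfl, Nat.zero_le _⟩
      ⟨rfl, Nat.zero_le _⟩ ⟨rfl, Nat.zero_le _⟩) (run_look_atom R v s h
        (fun i => hv _ ⟨i, rfl⟩) (σ.arity R - 1) ⟨0, σ.arity_pos R⟩
        (fun _ => Classical.arbitrary _) ?_ ?_)
    · simp [EvalState.trans, EvalState.start, hg, ht]
    · have := σ.arity_pos R
      simp only
      omega
    · intro j hj
      exact absurd hj (Nat.not_lt_zero _)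
  | and φ ψ ihφ ihψ =>
    intro p s h hv
    have h' := h
    simp only [Fml.encode, Seg, seg_append] at h'
    obtain ⟨h1, h2, h3, h4, -⟩ := h'
    have hpos : p + 1 + φ.encode.length + 1 + 1 = p + 1 + 1 + φ.encode.length + 1 := by omega
    have := binary φ ψ .and false (.inl ⟨rfl, rfl⟩) p _ _ h
      (ihφ h2 fun x hx => (hv x (.inl hx)).lparen h1)
      (ihψ (p := p + 1 + φ.encode.length + 1) (s := s) (by rw [hpos]; exact h4) fun x hx =>
        (hv x (.inr hx)).right h1 h2 (.inl rfl) (by convert h3 using 1; omega))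
    convert this using 2
    · rw [hpos]
      by_cases h : Fml.EvalAt A (annot w T.exVal) (annot w T.allVal) φ s (p + 1 + 1) <;>
        simp [Fml.EvalAt, h]
    · rfl
  | or φ ψ ihφ ihψ =>
    intro p s h hv
    have h' := h
    simp only [Fml.encode, Seg, seg_append] at h'
    obtain ⟨h1, h2, h3, h4, -⟩ := h'
    have hpos : p + 1 + φ.encode.length + 1 + 1 = p + 1 + 1 + φ.encode.length + 1 := by omega
    have := binary φ ψ .or true (.inr ⟨rfl, rfl⟩) p _ _ h
      (ihφ h2 fun x hx => (hv x (.inl hx)).lparen h1)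
      (ihψ (p := p + 1 + φ.encode.length + 1) (s := s) (by rw [hpos]; exact h4) fun x hx =>
        (hv x (.inr hx)).right h1 h2 (.inr rfl) (by convert h3 using 1; omega))
    convert this using 2
    · rw [hpos]
      by_cases h : Fml.EvalAt A (annot w T.exVal) (annot w T.allVal) φ s (p + 1 + 1) <;>
        simp [Fml.EvalAt, h]
    · rfl
  | ex x φ ih =>
    intro p s h hv
    simp only [Fml.encode, Seg, seg_append] at h
    obtain ⟨h1, h2, h3⟩ := h
    have hb1 := h1.bounds
    obtain ⟨g, hg, ht⟩ := h1
    have hq : QuantAt T w (p + 1) (annot w T.exVal (p + 1)) :=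
      ⟨g, hg, .inl ⟨ht, by simp [annot, hg]⟩⟩
    have hpos : p + 1 + 1 + (encodeVar σ x).length = p + 1 + (encodeVar σ x).length + 1 := by omega
    rw [hpos] at h3
    have r := ih h3 (hq.binds_update h2 hv)
    have r0 := (step (q := .eval) (q' := .qvar) hb1.2 (by simp [EvalState.trans, hg, ht])).trans
      (run_qvar h2)
    rw [hpos] at r0
    have := r0.trans r
    convert this using 2
    · simp only [Fml.EvalAt, hpos]
    · simp only [Fml.encode, List.length_cons, List.length_append]
      omega
  | all x φ ih =>
    intro p s h hv
    simp only [Fml.encode, Seg, seg_append] at h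
    obtain ⟨h1, h2, h3⟩ := h
    have hb1 := h1.bounds
    obtain ⟨g, hg, ht⟩ := h1
    have hq : QuantAt T w (p + 1) (annot w T.allVal (p + 1)) :=
      ⟨g, hg, .inr ⟨ht, by simp [annot, hg]⟩⟩
    have hpos : p + 1 + 1 + (encodeVar σ x).length = p + 1 + (encodeVar σ x).length + 1 := by omega
    rw [hpos] at h3
    have r := ih h3 (hq.binds_update h2 hv)
    have r0 := (step (q := .eval) (q' := .qvar) hb1.2 (by simp [EvalState.trans, hg, ht])).trans
      (run_qvar h2)
    rw [hpos] at r0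
    have := r0.trans r
    convert this using 2
    · simp only [Fml.EvalAt, hpos]
    · simp only [Fml.encode, List.length_cons, List.length_append]
      omega

theorem seg_of_drop {l : List (Token σ)} : ∀ {p : ℕ}, (w.map T.tok).drop p = l →
    T.Seg w (p + 1) l := by
  induction l with
  | nil => exact fun _ => trivial
  | cons t l ih =>
    intro p h
    have hp : p < w.length := by
      by_contra hp
      rw [List.drop_eq_nil_of_le (by simpa using hp)] at h
      cases h
    rw [List.drop_eq_getElem_cons (by simpa using hp)] at h
    injection h with h1 h2
    exact ⟨⟨w[p], readInput_of_lt hp, by simpa using h1⟩, ih h2⟩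

open Classical in
/-- On an annotated sentence the automaton halts with the truth value as its result. -/
theorem haltsIn_evalAutomaton (φ : Sentence σ) (s : ℕ → A.carrier)
    (hw : w.map T.tok = φ.1.encode) :
    (evalAutomaton T).HaltsIn w
      (EvalState.ret (decide (φ.1.EvalAt A (annot w T.exVal) (annot w T.allVal) s 1))) := by
  have h1 := run_eval (T := T) (w := w) φ.1 (p := 0) (s := s) (seg_of_drop hw) fun x hx => by
    rw [φ.2] at hx
    exact absurd hx (Set.notMem_empty _)
  have hl : φ.1.encode.length = w.length := by rw [← hw, List.length_map]
  have h0 : T.Run w (T.cfg .eval 0 0 0 0) (T.cfg .eval (0 + 1) 0 0 0) :=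
    run_one .right .stay .stay .stay rfl (input_right (Nat.zero_le _)) ⟨rfl, Nat.zero_le _⟩
      ⟨rfl, Nat.zero_le _⟩ ⟨rfl, Nat.zero_le _⟩
  have hinit : (evalAutomaton T).initCfg = T.cfg .eval 0 0 0 0 := by
    simp only [CounterAutomaton.initCfg, cfg]
    congr 1
    funext j
    change Fin 3 at j
    fin_cases j <;> rfl
  rw [← hinit] at h0
  refine ⟨_, h0.trans h1, ?_, rfl⟩
  refine Option.map_eq_none_iff.2 ?_
  simp only [CounterAutomaton.instr, cfg, evalAutomaton]
  -- The sentence fills the whole input, so the head is on the right end marker, where `ret` has no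
  -- instruction.
  rw [hl, Nat.zero_add, Nat.add_comm, readInput_of_ge le_rfl]
  rfl

end Reading

/-! ### Semantics -/

namespace Fml

variable {σ : Signature} {A B : RelStr σ}

/-- Only the positions occupied by the formula matter. Choices made for disjoint subformulas can
therefore be glued. -/
theorem evalAt_congr {ge ga ge' ga' : ℕ → A.carrier} (φ : Fml σ) : ∀ {s : ℕ → A.carrier} {p : ℕ},
    (∀ q, p ≤ q → q < p + φ.encode.length → ge q = ge' q ∧ ga q = ga' q) →
    (φ.EvalAt A ge ga s p ↔ φ.EvalAt A ge' ga' s p) := by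
  induction φ with
  | atom R v => exact fun _ => Iff.rfl
  | and φ ψ ihφ ihψ =>
    intro s p h
    simp only [encode, List.length_cons, List.length_append, List.length_nil] at h
    exact and_congr (ihφ fun q h1 h2 => h q (by omega) (by omega))
      (ihψ fun q h1 h2 => h q (by omega) (by omega))
  | or φ ψ ihφ ihψ =>
    intro s p h
    simp only [encode, List.length_cons, List.length_append, List.length_nil] at h
    exact or_congr (ihφ fun q h1 h2 => h q (by omega) (by omega))
      (ihψ fun q h1 h2 => h q (by omega) (by omega))
  | ex x φ ih =>
    intro s p h
    simp only [encode, List.length_cons, List.length_append] at h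
    simp only [EvalAt]
    rw [(h p le_rfl (by omega)).1]
    exact ih fun q h1 h2 => h q (by omega) (by omega)
  | all x φ ih =>
    intro s p h
    simp only [encode, List.length_cons, List.length_append] at h
    simp only [EvalAt]
    rw [(h p le_rfl (by omega)).2]
    exact ih fun q h1 h2 => h q (by omega) (by omega)

/-- A true formula has witnesses for its existential quantifiers, also if all universal ones
choose `a`. -/
theorem exists_witness_of_sat (a : A.carrier) (φ : Fml σ) : ∀ {s : ℕ → A.carrier} (p : ℕ),
    φ.Sat A s → ∃ g, φ.EvalAt A g (fun _ => a) s p := by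
  induction φ with
  | atom R v => exact fun p h => ⟨fun _ => a, h⟩
  | and φ ψ ihφ ihψ =>
    intro s p h
    obtain ⟨g, hg⟩ := ihφ (p + 1) h.1
    obtain ⟨g', hg'⟩ := ihψ (p + 1 + φ.encode.length + 1) h.2
    -- The threshold is the position of the connective, which separates the two operands.
    refine ⟨fun q => if q < p + 1 + φ.encode.length then g q else g' q,
      (evalAt_congr φ fun q h1 h2 => ⟨?_, rfl⟩).2 hg,
      (evalAt_congr ψ fun q h1 h2 => ⟨?_, rfl⟩).2 hg'⟩
    · exact if_pos h2
    · exact if_neg (by omega)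
  | or φ ψ ihφ ihψ =>
    rintro s p (h | h)
    · obtain ⟨g, hg⟩ := ihφ (p + 1) h
      exact ⟨g, .inl hg⟩
    · obtain ⟨g, hg⟩ := ihψ (p + 1 + φ.encode.length + 1) h
      exact ⟨g, .inr hg⟩
  | ex x φ ih =>
    rintro s p ⟨d, h⟩
    obtain ⟨g, hg⟩ := ih (p + 1 + (encodeVar σ x).length) h
    refine ⟨Function.update g p d, ?_⟩
    simp only [EvalAt, Function.update_self]
    refine (evalAt_congr φ fun q h1 h2 => ⟨?_, rfl⟩).2 hg
    exact Function.update_of_ne (by omega) _ _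
  | all x φ ih => exact fun p h => ih _ (h a)

/-- A false formula has counterexamples for its universal quantifiers, also if all existential ones
choose `b`. -/
theorem exists_counterexample_of_not_sat (b : A.carrier) (φ : Fml σ) :
    ∀ {s : ℕ → A.carrier} (p : ℕ), ¬ φ.Sat A s → ∃ g, ¬ φ.EvalAt A (fun _ => b) g s p := by
  induction φ with
  | atom R v => exact fun p h => ⟨fun _ => b, h⟩
  | or φ ψ ihφ ihψ =>
    intro s p h
    obtain ⟨h1, h2⟩ := not_or.1 h
    obtain ⟨g, hg⟩ := ihφ (p + 1) h1
    obtain ⟨g', hg'⟩ := ihψ (p + 1 + φ.encode.length + 1) h2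
    refine ⟨fun q => if q < p + 1 + φ.encode.length then g q else g' q, not_or.2
      ⟨fun h => hg ((evalAt_congr φ fun q h1 h2 => ⟨rfl, ?_⟩).1 h),
      fun h => hg' ((evalAt_congr ψ fun q h1 h2 => ⟨rfl, ?_⟩).1 h)⟩⟩
    · exact if_pos h2
    · exact if_neg (by omega)
  | and φ ψ ihφ ihψ =>
    intro s p h
    rcases not_and_or.1 h with h | h
    · obtain ⟨g, hg⟩ := ihφ (p + 1) h
      exact ⟨g, fun h => hg h.1⟩
    · obtain ⟨g, hg⟩ := ihψ (p + 1 + φ.encode.length + 1) h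
      exact ⟨g, fun h => hg h.2⟩
  | all x φ ih =>
    intro s p h
    obtain ⟨d, h⟩ := not_forall.1 h
    obtain ⟨g, hg⟩ := ih (p + 1 + (encodeVar σ x).length) h
    refine ⟨Function.update g p d, ?_⟩
    simp only [EvalAt, Function.update_self]
    refine fun h => hg ((evalAt_congr φ fun q h1 h2 => ⟨rfl, ?_⟩).1 h)
    exact Function.update_of_ne (by omega) _ _
  | ex x φ ih => exact fun p h => ih _ fun hb => h ⟨b, hb⟩

theorem update_mem {α β : Type} {f : α → Set β} {s : ℕ → α} {t : ℕ → β}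
    (h : ∀ x, t x ∈ f (s x)) {a : α} {b : β} (hab : b ∈ f a) (y : ℕ) :
    ∀ x, Function.update t y b x ∈ f (Function.update s y a x) := by
  intro x
  by_cases hx : x = y
  · subst hx
    simpa using hab
  · simpa [Function.update_of_ne hx] using h x

variable {f : A.carrier → Set B.carrier}

theorem sat_of_isSMuHom (hf : IsSMuHom A B f) (φ : Fml σ) :
    ∀ {s : ℕ → A.carrier} {t : ℕ → B.carrier}, (∀ x, t x ∈ f (s x)) → φ.Sat A s → φ.Sat B t := by
  induction φ with
  | atom R v => exact fun hst h => hf.map_rel R _ h _ fun i => hst (v i)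
  | and φ ψ ihφ ihψ => exact fun hst h => ⟨ihφ hst h.1, ihψ hst h.2⟩
  | or φ ψ ihφ ihψ => exact fun hst h => h.imp (ihφ hst) (ihψ hst)
  | ex x φ ih =>
    rintro s t hst ⟨d, h⟩
    obtain ⟨e, he⟩ := hf.value_nonempty d
    exact ⟨e, ih (update_mem hst he x) h⟩
  | all x φ ih =>
    intro s t hst h e
    obtain ⟨d, he⟩ := hf.surjective e
    exact ih (update_mem hst he x) (h d)

/-- At a universal quantifier any `e` in `B` lies in `f a`, so the one instance `a` that was
evaluated takes care of all of them. -/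
theorem sat_of_evalAt (hf : IsSMuHom A B f) {a : A.carrier} (ha : f a = Set.univ)
    {g : ℕ → A.carrier} (φ : Fml σ) : ∀ {s : ℕ → A.carrier} {t : ℕ → B.carrier} {p : ℕ},
    (∀ x, t x ∈ f (s x)) → φ.EvalAt A g (fun _ => a) s p → φ.Sat B t := by
  induction φ with
  | atom R v => exact fun hst h => hf.map_rel R _ h _ fun i => hst (v i)
  | and φ ψ ihφ ihψ => exact fun hst h => ⟨ihφ hst h.1, ihψ hst h.2⟩
  | or φ ψ ihφ ihψ => exact fun hst h => h.imp (ihφ hst) (ihψ hst)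
  | ex x φ ih =>
    intro s t p hst h
    obtain ⟨e, he⟩ := hf.value_nonempty (g p)
    exact ⟨e, ih (update_mem hst he x) h⟩
  | all x φ ih =>
    intro s t p hst h e
    exact ih (update_mem hst (ha ▸ Set.mem_univ e) x) h

/-- Whatever witness `d` makes an existential formula true in `A`, the element `b` lies in `f d` and
may replace it. A universal value `g p` is matched with a preimage. -/
theorem evalAt_of_sat (hf : IsSMuHom A B f) {b : B.carrier} (hb : mvInverse f b = Set.univ)
    {g : ℕ → B.carrier} (φ : Fml σ) : ∀ {s : ℕ → A.carrier} {t : ℕ → B.carrier} {p : ℕ},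
    (∀ x, t x ∈ f (s x)) → φ.Sat A s → φ.EvalAt B (fun _ => b) g t p := by
  induction φ with
  | atom R v => exact fun hst h => hf.map_rel R _ h _ fun i => hst (v i)
  | and φ ψ ihφ ihψ => exact fun hst h => ⟨ihφ hst h.1, ihψ hst h.2⟩
  | or φ ψ ihφ ihψ => exact fun hst h => h.imp (ihφ hst) (ihψ hst)
  | ex x φ ih =>
    rintro s t p hst ⟨d, h⟩
    have hd : d ∈ mvInverse f b := hb ▸ Set.mem_univ d
    exact ih (update_mem hst hd x) h
  | all x φ ih =>
    intro s t p hst h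
    obtain ⟨d, hd⟩ := hf.surjective (g p)
    exact ih (update_mem hst hd x) (h d)

end Fml

/-! ### Consequences for templates, and the membership results -/

variable {σ : Signature} {A B : RelStr σ}

theorem IsSMuHom.exists_preimage {f : A.carrier → Set B.carrier} (hf : IsSMuHom A B f)
    (t : ℕ → B.carrier) : ∃ s : ℕ → A.carrier, ∀ x, t x ∈ f (s x) := by
  choose s hs using fun x => hf.surjective (t x)
  exact ⟨s, hs⟩

theorem IsSMuHom.isTemplate {f : A.carrier → Set B.carrier} (hf : IsSMuHom A B f) :
    IsTemplate A B := by
  intro φ h t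
  obtain ⟨s, hs⟩ := hf.exists_preimage t
  exact φ.1.sat_of_isSMuHom hf hs (h s)

/-- An evaluation that falsifies `φ`, if there is one, decides its truth. This replaces a proof that
the truth of sentences is independent of the evaluation. -/
theorem exists_models_of_sat (A : RelStr σ) (φ : Sentence σ) :
    ∃ s : ℕ → A.carrier, φ.1.Sat A s → Models A φ := by
  by_cases h : Models A φ
  · exact ⟨fun _ => Classical.arbitrary _, fun _ => h⟩
  · obtain ⟨s, hs⟩ := not_forall.1 h
    exact ⟨s, fun h => absurd h hs⟩

namespace Reading

variable {Γ : Type} {T : Reading A Γ} {w : List Γ}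

theorem annot_of_lt (f : Γ → A.carrier) {i : ℕ} (hi : i < w.length) :
    annot w f (i + 1) = f w[i] := by
  simp only [annot, readInput_of_lt hi]

open Classical in
theorem haltsIn_of_values {φ : Sentence σ} (hw : w.map T.tok = φ.1.encode) {s : ℕ → A.carrier}
    {ge ga : ℕ → A.carrier}
    (h : ∀ i (hi : i < w.length), T.exVal w[i] = ge (i + 1) ∧ T.allVal w[i] = ga (i + 1)) :
    (evalAutomaton T).HaltsIn w (EvalState.ret (decide (φ.1.EvalAt A ge ga s 1))) := by
  have key : φ.1.EvalAt A (annot w T.exVal) (annot w T.allVal) s 1 ↔ φ.1.EvalAt A ge ga s 1 := by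
    refine φ.1.evalAt_congr fun q h1 h2 => ?_
    obtain ⟨i, rfl⟩ := Nat.exists_eq_add_of_le' h1
    have hi : i < w.length := by
      rw [← hw, List.length_map] at h2
      omega
    rw [annot_of_lt _ hi, annot_of_lt _ hi]
    exact h i hi
  have := haltsIn_evalAutomaton (T := T) φ s hw
  rwa [decide_eq_decide.2 key] at this

/-- The word `l` annotated with the values of `g` at its positions. -/
def withValues {Γ D : Type} (l : List Γ) (g : ℕ → D) : List (Γ × D) :=
  l.zipIdx.map fun t => (t.1, g (t.2 + 1))

theorem map_fst_withValues {Γ D : Type} (l : List Γ) (g : ℕ → D) :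
    (withValues l g).map Prod.fst = l := by
  rw [withValues, List.map_map]
  exact List.zipIdx_map_fst 0 l

theorem snd_withValues {Γ D : Type} (l : List Γ) (g : ℕ → D) (i : ℕ)
    (hi : i < (withValues l g).length) : (withValues l g)[i].2 = g (i + 1) := by
  simp [withValues]

end Reading

-- The automaton evaluates in `A`: the annotation supplies the existential values, and `a` is used
-- for every universal quantifier. Yes-instances have witnesses, and an accepted annotation
-- transfers to truth in `B`.
open Classical in
theorem PMC_inNP_of_isAShop (hAB : IsTemplate A B) {f : A.carrier → Set B.carrier}
    (hf : IsAShop A B f) : (PMC A B hAB).InNP := by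
  obtain ⟨hf, a, ha⟩ := hf
  let T : Reading A (Token σ × A.carrier) := ⟨Prod.fst, Prod.snd, fun _ => a⟩
  refine CounterAutomaton.inNP_of_haltsIn (PMC A B hAB) (D := A.carrier) (evalAutomaton T)
    {EvalState.ret true} (fun φ w hw => ?_) fun φ hφ => ?_
  · obtain ⟨t, ht⟩ := exists_models_of_sat B φ
    obtain ⟨s, hs⟩ := hf.exists_preimage t
    refine ⟨_, Reading.haltsIn_of_values (T := T) (φ := φ) hw (s := s)
      (ge := Reading.annot w T.exVal) (ga := fun _ => a)
      fun i hi => ⟨(Reading.annot_of_lt T.exVal hi).symm, rfl⟩, fun hno hq => hno (ht ?_)⟩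
    exact φ.1.sat_of_evalAt hf ha hs (of_decide_eq_true (EvalState.ret.inj hq))
  · obtain ⟨g, hg⟩ := φ.1.exists_witness_of_sat a 1 (hφ fun _ => a)
    have hw := Reading.map_fst_withValues φ.1.encode g
    refine ⟨_, hw, _, ?_, Reading.haltsIn_of_values (T := T) (φ := φ) hw (s := fun _ => a)
      (ge := g) (ga := fun _ => a) fun i hi => ⟨Reading.snd_withValues φ.1.encode g i hi, rfl⟩⟩
    rw [decide_eq_true hg]
    rfl

-- Dually, the automaton evaluates in `B` with `b` for every existential quantifier, the annotation
-- supplies universal values, and the result `false` accepts: a counterexample in `B` refutes truth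
-- in `A`.
open Classical in
theorem PMC_inCoNP_of_isEShop (hAB : IsTemplate A B) {f : A.carrier → Set B.carrier}
    (hf : IsEShop A B f) : (PMC A B hAB).InCoNP := by
  obtain ⟨hf, b, hb⟩ := hf
  let T : Reading B (Token σ × B.carrier) := ⟨Prod.fst, fun _ => b, Prod.snd⟩
  refine CounterAutomaton.inNP_of_haltsIn (PMC A B hAB).swap (D := B.carrier) (evalAutomaton T)
    {EvalState.ret false} (fun φ w hw => ?_) fun φ hφ => ?_
  · let t : ℕ → B.carrier := fun _ => b
    obtain ⟨s, hs⟩ := hf.exists_preimage t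
    refine ⟨_, Reading.haltsIn_of_values (T := T) (φ := φ) hw (s := t)
      (ge := fun _ => b) (ga := Reading.annot w T.allVal)
      fun i hi => ⟨rfl, (Reading.annot_of_lt T.allVal hi).symm⟩, fun hA hq => ?_⟩
    exact of_decide_eq_false (EvalState.ret.inj hq) (φ.1.evalAt_of_sat hf hb hs (hA s))
  · obtain ⟨t, ht⟩ := not_forall.1 (show ¬ Models B φ from hφ)
    obtain ⟨g, hg⟩ := φ.1.exists_counterexample_of_not_sat b 1 ht
    have hw := Reading.map_fst_withValues φ.1.encode g
    refine ⟨_, hw, _, ?_, Reading.haltsIn_of_values (T := T) (φ := φ) hw (s := t)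
      (ge := fun _ => b) (ga := g) fun i hi => ⟨rfl, Reading.snd_withValues φ.1.encode g i hi⟩⟩
    rw [decide_eq_false hg]
    rfl

open Classical in
/-- If a structure `C` between `A` and `B` has a reflexive surjective multi-homomorphism to itself
of both kinds, then no guessing is needed. -/
theorem PMC_inL_of_isEAShop {C : RelStr σ} (hAC : IsTemplate A C) (hCB : IsTemplate C B)
    (hAB : IsTemplate A B) {g : C.carrier → Set C.carrier} (hg : IsEAShop C C g)
    (hrefl : ∀ c, c ∈ g c) : (PMC A B hAB).InL := by
  obtain ⟨⟨hg, a, ha⟩, -, b, hb⟩ := hg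
  -- By reflexivity of `g` one evaluation can be used on both sides, so evaluating with these
  -- constants decides truth in `C`, which separates the two kinds of instances.
  let T : Reading C (Token σ) := ⟨id, fun _ => b, fun _ => a⟩
  refine CounterAutomaton.inL_of_haltsIn (PMC A B hAB) (evalAutomaton T) {EvalState.ret true}
    fun φ => ?_
  obtain ⟨s, hs⟩ := exists_models_of_sat C φ
  refine ⟨_, Reading.haltsIn_of_values (T := T) (φ := φ) (List.map_id _) (s := s)
    (ge := fun _ => b) (ga := fun _ => a) fun i hi => ⟨rfl, rfl⟩,
    fun hA => ?_, fun hB hq => hB (hCB φ (hs ?_))⟩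
  · rw [decide_eq_true (φ.1.evalAt_of_sat hg hb (fun x => hrefl _) (hAC φ hA s))]
    rfl
  · exact φ.1.sat_of_evalAt hg ha (fun x => hrefl _)
      (of_decide_eq_true (EvalState.ret.inj hq))

/-! ### The intermediate structure -/

/-- The structure on `{0, 1}` generated by the relations of `A`, where `a` is mapped to `{0, 1}` and
every other element to `{1}`. -/
def boolStr (A B : RelStr σ) {f : A.carrier → Set B.carrier} (hf : IsSMuHom A B f)
    {a : A.carrier} (ha : f a = Set.univ) : RelStr σ where
  carrier := Bool
  rel := fun R => {c | ∃ r ∈ A.rel R, ∀ i, c i = false → r i = a}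
  rel_nonempty := fun R => by
    obtain ⟨r, hr⟩ := A.rel_nonempty R
    exact ⟨fun _ => true, r, hr, fun i h => by cases h⟩
  -- The constant tuple `0` would come from `(a, …, a)` in `A.rel R`, and since `f a = B` this would
  -- make `B.rel R` full.
  rel_proper := fun R h => by
    have h0 : (fun _ => false) ∈ {c : Fin (σ.arity R) → Bool |
        ∃ r ∈ A.rel R, ∀ i, c i = false → r i = a} := h ▸ Set.mem_univ _
    obtain ⟨r, hr, hra⟩ := h0
    refine B.rel_proper R (Set.eq_univ_of_forall fun b => hf.map_rel R r hr b fun i => ?_)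
    rw [hra i rfl, ha]
    exact Set.mem_univ _

/-- The composite of `A → C`, sending `a` to `{0, 1}` and the rest to `{1}`, with `C → B`, sending
`0` to `B` and `1` to `{b}`, has values contained in those of `f`; this is why relations of `C` are
preserved in `B`. -/
theorem exists_boolStr {f : A.carrier → Set B.carrier} (hf : IsEAShop A B f) :
    ∃ C : RelStr σ, IsTemplate A C ∧ IsTemplate C B ∧
      ∃ g, IsEAShop C C g ∧ ∀ c, c ∈ g c := by
  obtain ⟨⟨hf, a, ha⟩, -, b, hb⟩ := hf
  refine ⟨boolStr A B hf ha, ?_, ?_, ?_⟩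
  · refine IsSMuHom.isTemplate (f := fun x => {c : Bool | c = false → x = a}) ⟨?_, ?_, ?_⟩
    · exact fun x => ⟨true, fun h => by cases h⟩
    · exact fun c => ⟨a, fun _ => rfl⟩
    · exact fun R r hr c hc => ⟨r, hr, hc⟩
  · refine IsSMuHom.isTemplate (f := fun c : Bool => {y | c = true → y = b}) ⟨?_, ?_, ?_⟩
    · exact fun c => ⟨b, fun _ => rfl⟩
    · exact fun y => ⟨false, fun h => by cases h⟩
    · rintro R c ⟨r, hr, hra⟩ y hy
      refine hf.map_rel R r hr y fun i => ?_
      cases hc : c i with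
      | false =>
        rw [hra i hc, ha]
        exact Set.mem_univ _
      | true =>
        rw [hy i hc]
        have : r i ∈ mvInverse f b := hb ▸ Set.mem_univ _
        exact this
  · have hg : IsSMuHom (boolStr A B hf ha) (boolStr A B hf ha)
        (fun c : Bool => {d : Bool | c = true → d = true}) := by
      refine ⟨fun c => ⟨true, fun _ => rfl⟩, fun d => ⟨false, fun h => by cases h⟩, ?_⟩
      rintro R c ⟨r, hr, hra⟩ d hd
      refine ⟨r, hr, fun i hi => hra i ?_⟩
      cases hc : c i with
      | false => rfl
      | true =>
        have : d i = true := hd i hc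
        rw [hi] at this
        cases this
    -- The value at `0` is everything, and `1` belongs to every value.
    refine ⟨_, ⟨⟨hg, false, ?_⟩, hg, true, ?_⟩, fun c h => h⟩
    · exact Set.eq_univ_of_forall fun d h => by cases h
    · exact Set.eq_univ_of_forall fun c _ => rfl

end PromiseMC

theorem mainTheorem4 (σ : PromiseMC.Signature) (A B : PromiseMC.RelStr σ)
    (hAB : PromiseMC.IsTemplate A B) :
    ((∃ f, PromiseMC.IsAShop A B f) → (PromiseMC.PMC A B hAB).InNP) ∧
    ((∃ f, PromiseMC.IsEShop A B f) → (PromiseMC.PMC A B hAB).InCoNP) ∧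
    ((∃ f, PromiseMC.IsEAShop A B f) →
      (PromiseMC.PMC A B hAB).InL ∧
      ∃ C : PromiseMC.RelStr σ, (∃ g, PromiseMC.IsEAShop C C g) ∧
        PromiseMC.IsRelaxation A B C C ∧ (PromiseMC.MC C).InL) := by
  refine ⟨fun ⟨f, hf⟩ => PromiseMC.PMC_inNP_of_isAShop hAB hf,
    fun ⟨f, hf⟩ => PromiseMC.PMC_inCoNP_of_isEShop hAB hf, fun ⟨f, hf⟩ => ?_⟩
  obtain ⟨C, hAC, hCB, g, hg, hrefl⟩ := PromiseMC.exists_boolStr hf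
  -- The same bound is used twice: with `C` between `A` and `B`, and with `C` between itself and
  -- itself.
  exact ⟨PromiseMC.PMC_inL_of_isEAShop hAC hCB hAB hg hrefl, C, ⟨g, hg⟩, ⟨hAC, hCB⟩,
    PromiseMC.PMC_inL_of_isEAShop (fun _ h => h) (fun _ h => h) _ hg hrefl⟩
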